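/- A $(k,\ell)$-Kneser coloring of a hypergraph $H=(V,E)$ is a function $\Delta\colon E\to\{1,\dots,k\}$ such that any two hyperedges $e\neq f$ with $\Delta(e)=\Delta(f)$ satisfy $|e\cap f|\ge \ell$. Let $\kappa(H,k,\ell)$ be the number of $(k,\ell)$-Kneser colorings of $H$, and let $\mathrm{KC}(n,r,k,\ell)$ be the maximum of $\kappa(H,k,\ell)$ over all $r$-uniform hypergraphs $H$ on $n$ vertices. For $n\ge\max\{r,\lceil k/3\rceil\ell\}$, let $H_{n,r,k,\ell}$ be the hypergraph with vertex set $[n]=\{1,\dots,n\}$ whose hyperedges are all the $r$-subsets of $[n]$ that contain at least one member of $C$, where $C$ is a fixed set of $\lceil k/3\rceil$ pairwise disjoint $\ell$-subsets of $[n]$ (up to isomorphism, $H_{n,r,k,\ell}$ does not depend on the choice of $C$). Theorem. Let $r\ge 2$, $k\ge 2$ and $1\le \ell<r$ be fixed integers. Then $$\mathrm{KC}(n,r,k,\ell)=(1+o(1))\cdot\kappa(H_{n,r,k,\ell},k,\ell),$$ where $o(1)$ is a function of $n$ that tends to $0$ as $n$ tends to infinity. -/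

import Mathlib

namespace KneserColoring

/-- `H` is `r`-uniform: every hyperedge has exactly `r` elements. -/
def IsUniform {α : Type*} (H : Hypergraph α) (r : ℕ) : Prop :=
  ∀ e ∈ H.edgeSet, e.encard = r

/-- `Δ` is a `(k, ℓ)`-Kneser coloring of `H`: any two hyperedges with the same color share at
least `ℓ` vertices. -/
def IsKneserColoring {α : Type*} (H : Hypergraph α) {k : ℕ} (ℓ : ℕ)
    (Δ : H.edgeSet → Fin k) : Prop :=
  ∀ e f : H.edgeSet, e ≠ f → Δ e = Δ f → (ℓ : ℕ∞) ≤ ((e : Set α) ∩ (f : Set α)).encard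

/-- `κ(H, k, ℓ)`: the number of `(k, ℓ)`-Kneser colorings of `H`. -/
noncomputable def kappa {α : Type*} (H : Hypergraph α) (k ℓ : ℕ) : ℕ :=
  Nat.card {Δ : H.edgeSet → Fin k // IsKneserColoring H ℓ Δ}

/-- The values `κ(H, k, ℓ)`, for `H` an `r`-uniform hypergraph with vertex set `Fin n`. -/
def kappaValues (n r k ℓ : ℕ) : Set ℕ :=
  {m | ∃ H : Hypergraph (Fin n), H.vertexSet = Set.univ ∧ IsUniform H r ∧ kappa H k ℓ = m}

/-- `KC(n, r, k, ℓ)`: the maximum of `κ(H, k, ℓ)` over all `r`-uniform hypergraphs `H` on `n`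
vertices. -/
noncomputable def KC (n r k ℓ : ℕ) : ℕ := sSup (kappaValues n r k ℓ)

/-- The supremum defining `KC` is an attained maximum. -/
theorem isGreatest_KC (n r k ℓ : ℕ) : IsGreatest (kappaValues n r k ℓ) (KC n r k ℓ) := by
  have hfin : (Set.univ : Set (Hypergraph (Fin n))).Finite := by
    have hinj : Function.Injective
        (fun H : Hypergraph (Fin n) => (H.vertexSet, H.edgeSet)) := by
      intro H K h
      simp only [Prod.mk.injEq] at h
      exact Hypergraph.ext h.1 h.2
    have := Finite.of_injective _ hinj
    exact Set.finite_univ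
  have hb : BddAbove (kappaValues n r k ℓ) := by
    refine ((hfin.image fun H => kappa H k ℓ).subset ?_).bddAbove
    rintro m ⟨H, -, -, rfl⟩
    exact ⟨H, Set.mem_univ _, rfl⟩
  have hne : (kappaValues n r k ℓ).Nonempty :=
    ⟨_, ⟨Set.univ, ∅, fun _ h => h.elim⟩, rfl, fun _ h => h.elim, rfl⟩
  exact ⟨Nat.sSup_mem hne hb, fun _ hm => le_csSup hb hm⟩

/-- The `(C, r)`-complete hypergraph `H_{C,r}(n)`: its vertex set is `Fin n` and its hyperedges
are all the `r`-subsets containing some member of `C`. -/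
def completeHypergraph {n : ℕ} (C : Finset (Finset (Fin n))) (r : ℕ) : Hypergraph (Fin n) where
  vertexSet := Set.univ
  edgeSet := {e | e.encard = r ∧ ∃ t ∈ C, (t : Set (Fin n)) ⊆ e}
  subset_vertexSet_of_mem_edgeSet' := fun e _ => Set.subset_univ e

/-- `C` consists of `⌈k / 3⌉` mutually disjoint `ℓ`-subsets of `Fin n`. For such `C`, the
hypergraph `completeHypergraph C r` is the hypergraph `H_{n,r,k,ℓ}` (unique up to isomorphism). -/
structure IsDisjointCover {n : ℕ} (C : Finset (Finset (Fin n))) (k ℓ : ℕ) : Prop where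
  card_eq : C.card = ⌈(k : ℚ) / 3⌉₊
  card_mem : ∀ t ∈ C, t.card = ℓ
  disjoint : ∀ s ∈ C, ∀ t ∈ C, s ≠ t → Disjoint s t

/-- Such a `C` exists as soon as `⌈k / 3⌉ * ℓ ≤ n` (and `ℓ` is positive). -/
theorem exists_isDisjointCover (n k ℓ : ℕ) (hℓ : 1 ≤ ℓ) (hn : ⌈(k : ℚ) / 3⌉₊ * ℓ ≤ n) :
    ∃ C : Finset (Finset (Fin n)), IsDisjointCover C k ℓ := by
  classical
  have hlt : ∀ (i : Fin ⌈(k : ℚ) / 3⌉₊) (j : Fin ℓ), (i : ℕ) * ℓ + j < n := fun i j => by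
    have h1 : ((i : ℕ) + 1) * ℓ ≤ ⌈(k : ℚ) / 3⌉₊ * ℓ := Nat.mul_le_mul_right _ i.isLt
    have := j.isLt
    nlinarith
  let g : Fin ⌈(k : ℚ) / 3⌉₊ → Fin ℓ → Fin n := fun i j => ⟨i * ℓ + j, hlt i j⟩
  have hdiv : ∀ i j, (g i j : ℕ) / ℓ = i := fun i j => by
    change ((i : ℕ) * ℓ + j) / ℓ = i
    rw [Nat.add_comm, Nat.add_mul_div_right _ _ (by omega), Nat.div_eq_of_lt j.isLt, zero_add]
  let t : Fin ⌈(k : ℚ) / 3⌉₊ → Finset (Fin n) := fun i => Finset.univ.image (g i)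
  have hdisj : ∀ i i', i ≠ i' → Disjoint (t i) (t i') := by
    intro i i' hne
    rw [Finset.disjoint_left]
    intro x hx hx'
    simp only [t, Finset.mem_image, Finset.mem_univ, true_and] at hx hx'
    obtain ⟨j, rfl⟩ := hx
    obtain ⟨j', hj'⟩ := hx'
    exact hne (Fin.ext (by rw [← hdiv i j, ← hj', hdiv]))
  have hinj : Function.Injective t := by
    intro i i' h
    by_contra hne
    have hd := hdisj i i' hne
    rw [← h, disjoint_self] at hd
    have hmem : g i ⟨0, hℓ⟩ ∈ t i := Finset.mem_image_of_mem _ (Finset.mem_univ _)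
    rw [hd] at hmem
    exact absurd hmem (Finset.notMem_empty _)
  refine ⟨Finset.univ.image t, ?_, ?_, ?_⟩
  · rw [Finset.card_image_of_injective _ hinj, Finset.card_univ, Fintype.card_fin]
  · intro s hs
    obtain ⟨i, -, rfl⟩ := Finset.mem_image.1 hs
    rw [Finset.card_image_of_injective, Finset.card_univ, Fintype.card_fin]
    intro j j' h
    have h' : (i : ℕ) * ℓ + j = i * ℓ + j' := congrArg Fin.val h
    exact Fin.ext (by omega)
  · intro s hs s' hs' hne
    obtain ⟨i, -, rfl⟩ := Finset.mem_image.1 hs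
    obtain ⟨i', -, rfl⟩ := Finset.mem_image.1 hs'
    exact hdisj i i' fun h => hne (h ▸ rfl)

end KneserColoring

/-! Write N = `(n - ℓ).choose (r - ℓ)` and P = `n ^ (r - ℓ - 1)`. Since N has order at least nP, a
factor (n + k + 1)^(O(P)) is negligible against x^N for any fixed 0 < x < 1. All estimates are made
up to such factors.

Each color class of a Kneser coloring is an ℓ-intersecting family of r-sets. Either it is a star,
that is, all its members contain a common ℓ-set (a center), or it has only O(P) members
(`card_le_of_intersecting`). Removing a small class leaves a coloring with one color fewer, so by
induction on the number of colors the total is at most maxProd(k)^N up to an error factor, and the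
colorings with a non-star class are negligible because maxProd(k - 1) < maxProd(k)
(`card_colorings_le`).

For star colorings with centers φ(1), ..., φ(k), almost every hyperedge contains at most one center
t, and then has as many choices as there are colors centered at t. The count is therefore about the
product of (fiber size)^(degree of the center). It is negligible unless the fiber sizes form a
partition of k with largest product and every center lies in at least half of the N possible
hyperedges. In the remaining case the set of centers is determined by the hypergraph: it is exactly
the set of ℓ-sets of large degree.

An optimal partition consists of parts 2, 3 and at most one 4. Splitting a 4 into 2 + 2 gives ⌈k/3⌉
parts, so the remaining assignments inject into balanced maps to a set J with ⌈k/3⌉ elements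
(`exists_factorization`). For a fixed balanced map, moving the centers apart never decreases the
number of choices, as all fibers have size at least two (`choices_le_choices_update`). Hence every
hypergraph has at most `totalChoices` colorings, up to a negligible error
(`card_colorings_le_totalChoices_add`).

For disjoint centers indexed by J, `totalChoices` counts pairs of a balanced map and a compatible
coloring of the extremal hypergraph. A coloring compatible with two balanced maps is rare, so a
Bonferroni inequality bounds `totalChoices` by the number of colorings plus a negligible error
(`totalChoices_le`). The two bounds together give the asymptotic equality. -/

namespace KneserColoring

/-! ### Partitions of an integer with the largest product -/

open Finset

/-- The largest product of the parts of a partition of `m`. -/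
def maxProd (m : ℕ) : ℕ :=
  (univ : Finset (Nat.Partition m)).sup fun p => p.parts.prod

theorem prod_le_maxProd (s : Multiset ℕ) (hs : ∀ x ∈ s, 0 < x) : s.prod ≤ maxProd s.sum :=
  Finset.le_sup (f := fun p : Nat.Partition s.sum => p.parts.prod)
    (mem_univ (⟨s, fun {_} h => hs _ h, rfl⟩ : Nat.Partition s.sum))

theorem exists_prod_eq_maxProd (m : ℕ) :
    ∃ s : Multiset ℕ, (∀ x ∈ s, 0 < x) ∧ s.sum = m ∧ s.prod = maxProd m := by
  obtain ⟨p, -, hp⟩ := Finset.exists_mem_eq_sup (univ : Finset (Nat.Partition m))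
    univ_nonempty (fun p => p.parts.prod)
  exact ⟨p.parts, fun x hx => p.parts_pos hx, p.parts_sum, hp.symm⟩

theorem prod_pos_of_forall_pos {s : Multiset ℕ} (hs : ∀ x ∈ s, 0 < x) : 0 < s.prod :=
  Nat.pos_of_ne_zero fun h => absurd (hs 0 (Multiset.prod_eq_zero_iff.1 h)) (lt_irrefl 0)

theorem maxProd_pos (m : ℕ) : 0 < maxProd m := by
  obtain ⟨s, hs, -, h⟩ := exists_prod_eq_maxProd m
  exact h ▸ prod_pos_of_forall_pos hs

/-- Enlarging any one part increases the product. The case `m = 0` is excluded, since there is no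
part to enlarge. -/
theorem maxProd_lt_succ {m : ℕ} (hm : 1 ≤ m) : maxProd m < maxProd (m + 1) := by
  obtain ⟨s, hs, hsum, h⟩ := exists_prod_eq_maxProd m
  have hne : s ≠ 0 := by rintro rfl; simp at hsum; omega
  obtain ⟨a, ha⟩ := Multiset.exists_mem_of_ne_zero hne
  obtain ⟨u, rfl⟩ := Multiset.exists_cons_of_mem ha
  have hu : ∀ x ∈ u, 0 < x := fun x hx => hs x (Multiset.mem_cons_of_mem hx)
  have h1 := prod_le_maxProd ((a + 1) ::ₘ u) (by
    intro x hx
    rcases Multiset.mem_cons.1 hx with rfl | hx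
    · omega
    · exact hu x hx)
  have hpos := prod_pos_of_forall_pos hu
  simp only [Multiset.sum_cons, Multiset.prod_cons] at h1 hsum h
  rw [show a + 1 + u.sum = m + 1 by omega] at h1
  nlinarith

theorem maxProd_mono : Monotone maxProd := by
  refine monotone_nat_of_le_succ fun m => ?_
  rcases Nat.eq_zero_or_pos m with rfl | hm
  · have : maxProd 0 = 1 := by
      obtain ⟨s, hs, hsum, h⟩ := exists_prod_eq_maxProd 0
      have : s = 0 := by
        by_contra hne
        obtain ⟨a, ha⟩ := Multiset.exists_mem_of_ne_zero hne
        have := Multiset.le_sum_of_mem ha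
        have := hs a ha
        omega
      rw [← h, this]; rfl
    rw [this]
    exact maxProd_pos _
  · exact (maxProd_lt_succ hm).le

/-- A multiset of positive integers whose product is the largest possible for its sum. -/
def IsOptimal (s : Multiset ℕ) : Prop := (∀ x ∈ s, 0 < x) ∧ s.prod = maxProd s.sum

/-- Exchange argument: the product of the untouched parts `v` is positive and cancels. The moves
used below are 1, b → b + 1; a → 2, a - 2 for a ≥ 5; 4, 4 → 3, 3, 2; 2, 2, 2 → 3, 3; and 4, 2 → 3,
3. Each increases the product. -/
theorem IsOptimal.prod_le {u v u' : Multiset ℕ} (h : IsOptimal (u + v))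
    (hu' : ∀ x ∈ u', 0 < x) (hsum : u'.sum = u.sum) : u'.prod ≤ u.prod := by
  have hv : ∀ x ∈ v, 0 < x := fun x hx => h.1 x (Multiset.mem_add.2 (Or.inr hx))
  have h1 := prod_le_maxProd (u' + v) fun x hx => (Multiset.mem_add.1 hx).elim (hu' x) (hv x)
  rw [Multiset.sum_add, hsum, ← Multiset.sum_add, ← h.2, Multiset.prod_add,
    Multiset.prod_add] at h1
  exact Nat.le_of_mul_le_mul_right h1 (prod_pos_of_forall_pos hv)

theorem IsOptimal.prod_le_of_le {u s u' : Multiset ℕ} (h : IsOptimal s) (hu : u ≤ s)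
    (hu' : ∀ x ∈ u', 0 < x) (hsum : u'.sum = u.sum) : u'.prod ≤ u.prod := by
  obtain ⟨v, rfl⟩ := Multiset.le_iff_exists_add.1 hu
  exact h.prod_le hu' hsum

theorem IsOptimal.one_notMem {s : Multiset ℕ} (h : IsOptimal s) (hs : 2 ≤ s.sum) : 1 ∉ s := by
  intro h1
  obtain ⟨u, rfl⟩ := Multiset.exists_cons_of_mem h1
  have hne : u ≠ 0 := by rintro rfl; simp at hs
  obtain ⟨b, hb⟩ := Multiset.exists_mem_of_ne_zero hne
  obtain ⟨v, rfl⟩ := Multiset.exists_cons_of_mem hb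
  have := IsOptimal.prod_le (u := {1, b}) (v := v) (u' := {b + 1})
    (by simpa [Multiset.insert_eq_cons] using h) (by simp) (by simp [add_comm])
  simp at this

theorem IsOptimal.le_four {s : Multiset ℕ} (h : IsOptimal s) {a : ℕ} (ha : a ∈ s) : a ≤ 4 := by
  by_contra! h4
  have := h.prod_le_of_le (u := {a}) (u' := {2, a - 2}) (by simpa using ha)
    (by simp [Multiset.insert_eq_cons]; omega) (by simp [Multiset.insert_eq_cons]; omega)
  simp [Multiset.insert_eq_cons] at this
  omega

theorem IsOptimal.count_four_le {s : Multiset ℕ} (h : IsOptimal s) : s.count 4 ≤ 1 := by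
  by_contra! h4
  have := h.prod_le_of_le (u := Multiset.replicate 2 4) (u' := {3, 3, 2})
    (Multiset.le_count_iff_replicate_le.1 h4) (by simp [Multiset.insert_eq_cons]) (by decide)
  revert this
  decide

theorem IsOptimal.count_two_le {s : Multiset ℕ} (h : IsOptimal s) : s.count 2 ≤ 2 := by
  by_contra! h4
  have := h.prod_le_of_le (u := Multiset.replicate 3 2) (u' := {3, 3})
    (Multiset.le_count_iff_replicate_le.1 h4) (by simp [Multiset.insert_eq_cons]) (by decide)
  revert this
  decide

theorem IsOptimal.two_notMem_of_four_mem {s : Multiset ℕ} (h : IsOptimal s) (h4 : 4 ∈ s) :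
    2 ∉ s := by
  intro h2
  obtain ⟨u, rfl⟩ := Multiset.exists_cons_of_mem h4
  have h2u : 2 ∈ u := by simpa using h2
  obtain ⟨v, rfl⟩ := Multiset.exists_cons_of_mem h2u
  have := IsOptimal.prod_le (u := {4, 2}) (v := v) (u' := {3, 3})
    (by simpa [Multiset.insert_eq_cons] using h) (by simp [Multiset.insert_eq_cons]) (by decide)
  revert this
  decide

theorem IsOptimal.two_le {s : Multiset ℕ} (h : IsOptimal s) (hs : 2 ≤ s.sum) {a : ℕ}
    (ha : a ∈ s) : 2 ≤ a := by
  have h0 := h.1 a ha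
  have h1 : a ≠ 1 := by rintro rfl; exact h.one_notMem hs ha
  omega

theorem IsOptimal.eq_replicate {s : Multiset ℕ} (h : IsOptimal s) (hs : 2 ≤ s.sum) :
    s = Multiset.replicate (s.count 2) 2 + Multiset.replicate (s.count 3) 3 +
      Multiset.replicate (s.count 4) 4 := by
  ext a
  simp only [Multiset.count_add, Multiset.count_replicate]
  by_cases ha : a ∈ s
  · have h1 := h.le_four ha
    have h2 := h.two_le hs ha
    interval_cases a <;> simp
  · rw [Multiset.count_eq_zero_of_notMem ha]
    split_ifs with h2 h3 h4 <;> simp_all [Multiset.count_eq_zero_of_notMem]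

/-- Only two shapes survive: threes with at most two twos, or threes with a single four. In the
second shape the number of parts is one short of ⌈sum/3⌉, which splitting the four repairs. -/
theorem IsOptimal.card_eq {s : Multiset ℕ} (h : IsOptimal s) (hs : 2 ≤ s.sum) :
    (s.count 4 = 0 ∧ s.card = (s.sum + 2) / 3) ∨
      (s.count 4 = 1 ∧ s.count 2 = 0 ∧ s.card + 1 = (s.sum + 2) / 3) := by
  have h4 := h.count_four_le
  have h2 := h.count_two_le
  have h42 : s.count 4 = 1 → s.count 2 = 0 := fun h1 =>
    Multiset.count_eq_zero_of_notMem (h.two_notMem_of_four_mem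
      (Multiset.count_pos.1 (by omega)))
  have he := h.eq_replicate hs
  have hc := congrArg Multiset.card he
  have hsum := congrArg Multiset.sum he
  simp only [Multiset.card_add, Multiset.card_replicate, Multiset.sum_add,
    Multiset.sum_replicate, smul_eq_mul] at hc hsum
  omega

theorem ceil_div_three (k : ℕ) : ⌈(k : ℚ) / 3⌉₊ = (k + 2) / 3 := by
  refine eq_of_forall_ge_iff fun c => ?_
  rw [Nat.ceil_le, div_le_iff₀ (by norm_num)]
  constructor
  · intro h
    have : k ≤ c * 3 := by exact_mod_cast h
    omega
  · intro h
    have : k ≤ c * 3 := by omega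
    exact_mod_cast this

/-! ### Fiber sizes of a map as a partition -/

section Fibers

variable {γ δ : Type*} [DecidableEq δ]

/-- The sizes of the nonempty fibers of `φ` on `M`. -/
def fiberSizes (M : Finset γ) (φ : γ → δ) : Multiset ℕ :=
  (M.image φ).val.map fun t => #{σ ∈ M | φ σ = t}

theorem prod_fiberSizes (M : Finset γ) (φ : γ → δ) :
    (fiberSizes M φ).prod = ∏ t ∈ M.image φ, #{σ ∈ M | φ σ = t} := rfl

theorem card_fiberSizes (M : Finset γ) (φ : γ → δ) :
    Multiset.card (fiberSizes M φ) = #(M.image φ) := by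
  rw [fiberSizes, Multiset.card_map]
  rfl

theorem sum_fiberSizes (M : Finset γ) (φ : γ → δ) : (fiberSizes M φ).sum = #M :=
  (card_eq_sum_card_image φ M).symm

theorem fiberSizes_pos (M : Finset γ) (φ : γ → δ) : ∀ x ∈ fiberSizes M φ, 0 < x := by
  intro x hx
  obtain ⟨t, ht, rfl⟩ := Multiset.mem_map.1 hx
  obtain ⟨σ, hσ, h⟩ := mem_image.1 ht
  exact card_pos.2 ⟨σ, mem_filter.2 ⟨hσ, h⟩⟩

theorem mem_fiberSizes {M : Finset γ} {φ : γ → δ} {t : δ} (ht : t ∈ M.image φ) :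
    #{σ ∈ M | φ σ = t} ∈ fiberSizes M φ :=
  Multiset.mem_map.2 ⟨t, ht, rfl⟩

theorem prod_card_fiber_le (M : Finset γ) (φ : γ → δ) :
    ∏ t ∈ M.image φ, #{σ ∈ M | φ σ = t} ≤ maxProd #M := by
  have := prod_le_maxProd (fiberSizes M φ) (fiberSizes_pos M φ)
  rwa [sum_fiberSizes, prod_fiberSizes] at this

theorem isOptimal_fiberSizes {M : Finset γ} {φ : γ → δ}
    (h : ∏ t ∈ M.image φ, #{σ ∈ M | φ σ = t} = maxProd #M) : IsOptimal (fiberSizes M φ) :=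
  ⟨fiberSizes_pos M φ, by rw [prod_fiberSizes, sum_fiberSizes, h]⟩

end Fibers

/-- The maps from `Fin k` to `J` with all fibers of size at least two whose fiber sizes have the
largest possible product. -/
def balancedMaps (k : ℕ) (J : Type*) [Fintype J] [DecidableEq J] : Finset (Fin k → J) :=
  {α | (∀ i, 2 ≤ #{σ | α σ = i}) ∧ ∏ i, #{σ | α σ = i} = maxProd k}

theorem surjective_of_mem_balancedMaps {k : ℕ} {J : Type*} [Fintype J] [DecidableEq J]
    {α : Fin k → J} (h : α ∈ balancedMaps k J) : Function.Surjective α := by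
  intro i
  have := (mem_filter.1 h).2.1 i
  obtain ⟨σ, hσ⟩ := card_pos.1 (by omega : 0 < #{σ | α σ = i})
  exact ⟨σ, (mem_filter.1 hσ).2⟩

/-- The maps with image `T` whose fiber sizes have the largest possible product. -/
def optimalMaps (k : ℕ) {X : Type*} [DecidableEq X] (T : Finset X) : Set (Fin k → X) :=
  {φ | univ.image φ = T ∧ ∏ t ∈ T, #{σ | φ σ = t} = maxProd k}

/-! ### From optimal maps to balanced maps by splitting a fiber of size four -/

section Splitting

variable {k : ℕ} {X : Type*} [DecidableEq X] {T : Finset X}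

theorem isOptimal_of_mem_optimalMaps {φ : Fin k → X} (h : φ ∈ optimalMaps k T) :
    IsOptimal (fiberSizes univ φ) := by
  refine isOptimal_fiberSizes ?_
  rw [h.1, h.2, card_univ, Fintype.card_fin]

theorem mem_of_mem_optimalMaps {φ : Fin k → X} (h : φ ∈ optimalMaps k T) (σ : Fin k) :
    φ σ ∈ T := h.1 ▸ mem_image_of_mem φ (mem_univ σ)

theorem two_le_of_mem_optimalMaps (hk : 2 ≤ k) {φ : Fin k → X} (h : φ ∈ optimalMaps k T)
    {t : X} (ht : t ∈ T) : 2 ≤ #{σ | φ σ = t} :=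
  (isOptimal_of_mem_optimalMaps h).two_le (by simpa [sum_fiberSizes] using hk)
    (mem_fiberSizes (by rwa [h.1]))

theorem exists_factorization_of_card_eq (hk : 2 ≤ k) {J : Type*} [Fintype J] [DecidableEq J]
    [Nonempty J]
    (hT : #T = Fintype.card J) :
    ∃ Ψ : (Fin k → X) → (Fin k → J), Set.InjOn Ψ (optimalMaps k T) ∧
      ∀ φ ∈ optimalMaps k T, Ψ φ ∈ balancedMaps k J ∧ ∃ t : J → X, φ = t ∘ Ψ φ := by
  let e : T ≃ J := Fintype.equivOfCardEq (by simpa using hT)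
  have j0 : J := Classical.arbitrary J
  let Ψ : (Fin k → X) → (Fin k → J) := fun φ σ => if h : φ σ ∈ T then e ⟨φ σ, h⟩ else j0
  have hΨ : ∀ φ ∈ optimalMaps k T, φ = (fun j => (e.symm j : X)) ∘ Ψ φ := by
    intro φ hφ
    funext σ
    simp [Ψ, mem_of_mem_optimalMaps hφ σ]
  refine ⟨Ψ, fun φ hφ φ' hφ' h => ?_, fun φ hφ => ⟨?_, _, hΨ φ hφ⟩⟩
  · rw [hΨ φ hφ, hΨ φ' hφ', h]
  · have hfib : ∀ i, #{σ | Ψ φ σ = i} = #{σ | φ σ = e.symm i} := by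
      intro i
      congr 1
      ext σ
      conv_rhs => rw [hΨ φ hφ]
      simp [Subtype.ext_iff.symm]
    refine mem_filter.2 ⟨mem_univ _, fun i => ?_, ?_⟩
    · rw [hfib]
      exact two_le_of_mem_optimalMaps hk hφ (e.symm i).2
    · simp_rw [hfib]
      rw [Equiv.prod_comp e.symm (fun t : T => #{σ | φ σ = t}),
        prod_coe_sort T (fun t => #{σ | φ σ = t}), hφ.2]

/-- The unique fiber of size four is split into two pairs, one of which is sent to the extra element
`none` of `Option T ≃ J`. The map can be recovered after the split because no other fiber has size
two. -/
theorem exists_factorization_of_card_succ_eq (hk : 2 ≤ k) {J : Type*} [Fintype J] [DecidableEq J]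
    (hT : #T + 1 = Fintype.card J)
    (h4 : ∀ φ ∈ optimalMaps k T, (fiberSizes univ φ).count 4 = 1 ∧
      (fiberSizes univ φ).count 2 = 0) :
    ∃ Ψ : (Fin k → X) → (Fin k → J), Set.InjOn Ψ (optimalMaps k T) ∧
      ∀ φ ∈ optimalMaps k T, Ψ φ ∈ balancedMaps k J ∧ ∃ t : J → X, φ = t ∘ Ψ φ := by
  let e : Option T ≃ J := Fintype.equivOfCardEq (by simpa using hT)
  have hQ : ∀ φ : Fin k → X, ∃ p : X × Finset (Fin k), φ ∈ optimalMaps k T →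
      p.1 ∈ T ∧ #{σ | φ σ = p.1} = 4 ∧ p.2 ⊆ ({σ | φ σ = p.1} : Finset (Fin k)) ∧ #p.2 = 2 := by
    intro φ
    by_cases hφ : φ ∈ optimalMaps k T
    · have : 4 ∈ fiberSizes univ φ := Multiset.count_pos.1 (by rw [(h4 φ hφ).1]; norm_num)
      obtain ⟨t, ht, h⟩ := Multiset.mem_map.1 this
      obtain ⟨Q, hQ, hQ2⟩ := exists_subset_card_eq (s := ({σ | φ σ = t} : Finset (Fin k))) (n := 2) (by omega)
      exact ⟨(t, Q), fun _ => ⟨by rw [← hφ.1]; exact ht, h, hQ, hQ2⟩⟩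
    · exact ⟨(φ ⟨0, by omega⟩, ∅), fun h => absurd h hφ⟩
  choose p hp using hQ
  -- The set `(p φ).2` is the pair split off from the fiber over the special center `(p φ).1`. The
  -- last `else` is a default that is never reached for an optimal `φ`.
  let Ψ : (Fin k → X) → (Fin k → J) := fun φ σ =>
    if σ ∈ (p φ).2 then e none else if h : φ σ ∈ T then e (some ⟨φ σ, h⟩) else e none
  have hΨ : ∀ φ ∈ optimalMaps k T, ∀ σ, (σ ∈ (p φ).2 → e.symm (Ψ φ σ) = none) ∧
      (σ ∉ (p φ).2 → (e.symm (Ψ φ σ)).map Subtype.val = some (φ σ)) := by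
    intro φ hφ σ
    constructor <;> intro h <;> simp [Ψ, h, mem_of_mem_optimalMaps hφ σ]
  have hnone : ∀ φ ∈ optimalMaps k T, ∀ σ, e.symm (Ψ φ σ) = none ↔ σ ∈ (p φ).2 := by
    intro φ hφ σ
    refine ⟨fun h => ?_, (hΨ φ hφ σ).1⟩
    by_contra hσ
    have := (hΨ φ hφ σ).2 hσ
    rw [h] at this
    simp at this
  have hsome : ∀ φ ∈ optimalMaps k T, ∀ σ (t : T), e.symm (Ψ φ σ) = some t ↔
      σ ∉ (p φ).2 ∧ φ σ = t := by
    intro φ hφ σ t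
    constructor
    · intro h
      have hσ : σ ∉ (p φ).2 := fun hσ => by
        rw [(hΨ φ hφ σ).1 hσ] at h; simp at h
      have := (hΨ φ hφ σ).2 hσ
      rw [h] at this
      exact ⟨hσ, by simpa using this.symm⟩
    · rintro ⟨hσ, h⟩
      have := (hΨ φ hφ σ).2 hσ
      rw [h] at this
      obtain ⟨t', ht', h'⟩ := Option.map_eq_some_iff.1 this
      rw [ht', Subtype.ext h']
  have hfib_none : ∀ φ ∈ optimalMaps k T, #{σ | e.symm (Ψ φ σ) = none} = 2 := by
    intro φ hφ
    rw [← (hp φ hφ).2.2.2]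
    congr 1
    ext σ
    simp [hnone φ hφ σ]
  have hfib_special : ∀ φ (hφ : φ ∈ optimalMaps k T),
      #{σ | e.symm (Ψ φ σ) = some ⟨(p φ).1, (hp φ hφ).1⟩} = 2 := by
    intro φ hφ
    have : ({σ | e.symm (Ψ φ σ) = some ⟨(p φ).1, (hp φ hφ).1⟩} : Finset (Fin k)) =
        ({σ | φ σ = (p φ).1} : Finset (Fin k)) \ (p φ).2 := by
      ext σ
      simp [hsome φ hφ σ, and_comm]
    rw [this, card_sdiff_of_subset (hp φ hφ).2.2.1, (hp φ hφ).2.1, (hp φ hφ).2.2.2]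
  have hfib : ∀ φ ∈ optimalMaps k T, ∀ t : T, (t : X) ≠ (p φ).1 →
      #{σ | e.symm (Ψ φ σ) = some t} = #{σ | φ σ = t} := by
    intro φ hφ t ht
    congr 1
    ext σ
    simp only [hsome φ hφ σ, mem_filter, mem_univ, true_and, and_iff_right_iff_imp]
    intro h hσ
    have := (mem_filter.1 ((hp φ hφ).2.2.1 hσ)).2
    exact ht (h.symm.trans this)
  have hne2 : ∀ φ ∈ optimalMaps k T, ∀ t ∈ T, #{σ | φ σ = t} ≠ 2 := by
    intro φ hφ t ht h2
    have := mem_fiberSizes (M := univ) (φ := φ) (t := t) (by rwa [hφ.1])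
    rw [h2] at this
    exact absurd (Multiset.count_pos.2 this) (by rw [(h4 φ hφ).2]; norm_num)
  have hfac : ∀ φ ∈ optimalMaps k T, φ =
      (fun j => ((e.symm j).map Subtype.val).getD (p φ).1) ∘ Ψ φ := by
    intro φ hφ
    funext σ
    by_cases hσ : σ ∈ (p φ).2
    · simp only [Function.comp, (hΨ φ hφ σ).1 hσ, Option.map_none, Option.getD_none]
      exact (mem_filter.1 ((hp φ hφ).2.2.1 hσ)).2
    · simp only [Function.comp, (hΨ φ hφ σ).2 hσ, Option.getD_some]
  refine ⟨Ψ, ?_, fun φ hφ => ⟨?_, _, hfac φ hφ⟩⟩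
  · intro φ hφ φ' hφ' h
    -- If the special centers differed, the fiber of `φ'` over the special center of `φ` would have
    -- size two, and optimal maps of this shape have no such fiber.
    have hspec : (p φ).1 = (p φ').1 := by
      by_contra hne
      have h1 := hfib_special φ hφ
      rw [h, hfib φ' hφ' _ hne] at h1
      exact hne2 φ' hφ' _ (hp φ hφ).1 h1
    rw [hfac φ hφ, hfac φ' hφ', h, hspec]
  · have hfibJ : ∀ i, #{σ | Ψ φ σ = i} = #{σ | e.symm (Ψ φ σ) = e.symm i} := by
      intro i
      simp
    refine mem_filter.2 ⟨mem_univ _, fun i => ?_, ?_⟩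
    · rw [hfibJ]
      rcases h : e.symm i with _ | t
      · exact (hfib_none φ hφ).ge
      · by_cases ht : (t : X) = (p φ).1
        · rw [show t = ⟨(p φ).1, (hp φ hφ).1⟩ from Subtype.ext ht]
          exact (hfib_special φ hφ).ge
        · rw [hfib φ hφ t ht]
          exact two_le_of_mem_optimalMaps hk hφ t.2
    · simp_rw [hfibJ]
      rw [Equiv.prod_comp e.symm (fun o => #{σ | e.symm (Ψ φ σ) = o}), Fintype.prod_option,
        hfib_none φ hφ, ← hφ.2, ← prod_coe_sort T (fun t => #{σ | φ σ = t}),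
        ← mul_prod_erase univ _ (mem_univ ⟨(p φ).1, (hp φ hφ).1⟩),
        ← mul_prod_erase univ (fun t : T => #{σ | φ σ = t}) (mem_univ ⟨(p φ).1, (hp φ hφ).1⟩),
        hfib_special φ hφ]
      change _ = #{σ | φ σ = (p φ).1} * _
      have h4' := (hp φ hφ).2.1
      rw [← mul_assoc]
      refine congrArg₂ _ h4'.symm (prod_congr rfl fun t ht => hfib φ hφ t fun h => ?_)
      exact (mem_erase.1 ht).1 (Subtype.ext h)

/-- Every optimal map with image `T` factors through a balanced map to a type with `⌈k/3⌉`
elements, and distinct optimal maps give distinct balanced maps. -/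
theorem exists_factorization (hk : 2 ≤ k) {J : Type*} [Fintype J] [DecidableEq J]
    (hJ : Fintype.card J = (k + 2) / 3) (T : Finset X) :
    ∃ Ψ : (Fin k → X) → (Fin k → J), Set.InjOn Ψ (optimalMaps k T) ∧
      ∀ φ ∈ optimalMaps k T, Ψ φ ∈ balancedMaps k J ∧ ∃ t : J → X, φ = t ∘ Ψ φ := by
  have key : ∀ φ ∈ optimalMaps k T, _ := fun φ hφ =>
    (isOptimal_of_mem_optimalMaps hφ).card_eq (by simpa [sum_fiberSizes] using hk)
  have hcard : ∀ φ ∈ optimalMaps k T, Multiset.card (fiberSizes univ φ) = #T := fun φ hφ => by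
    rw [card_fiberSizes, hφ.1]
  simp only [sum_fiberSizes, card_univ, Fintype.card_fin] at key
  have : Nonempty J := Fintype.card_pos_iff.1 (by omega)
  by_cases hT : #T = Fintype.card J
  · exact exists_factorization_of_card_eq hk hT
  by_cases hT' : #T + 1 = Fintype.card J
  · refine exists_factorization_of_card_succ_eq hk hT' fun φ hφ => ?_
    have := key φ hφ
    rw [hcard φ hφ] at this
    omega
  -- For any other size of `T` there are no optimal maps at all, and `Ψ` is arbitrary.
  have he : ∀ φ, φ ∉ optimalMaps k T := by
    intro φ hφ
    have := key φ hφ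
    rw [hcard φ hφ] at this
    omega
  exact ⟨fun _ _ => Classical.arbitrary J, fun φ hφ => absurd hφ (he φ),
    fun φ hφ => absurd hφ (he φ)⟩

/-- Every large part of an optimal multiset can be split until there is no part `4`. -/
theorem exists_isOptimal_card (hk : 2 ≤ k) :
    ∃ s : Multiset ℕ, (∀ x ∈ s, 2 ≤ x) ∧ s.sum = k ∧ s.prod = maxProd k ∧
      Multiset.card s = (k + 2) / 3 := by
  obtain ⟨s, hs, hsum, hprod⟩ := exists_prod_eq_maxProd k
  have ho : IsOptimal s := ⟨hs, by rw [hprod, hsum]⟩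
  have h2 : ∀ x ∈ s, 2 ≤ x := fun x hx => ho.two_le (by omega) hx
  rcases ho.card_eq (by omega) with ⟨-, h⟩ | ⟨h4, -, h⟩
  · exact ⟨s, h2, hsum, hprod, by rw [h, hsum]⟩
  · obtain ⟨u, rfl⟩ := Multiset.exists_cons_of_mem (Multiset.count_pos.1 (by omega : 0 < s.count 4))
    refine ⟨2 ::ₘ 2 ::ₘ u, ?_, ?_, ?_, ?_⟩
    · intro x hx
      simp only [Multiset.mem_cons] at hx h2
      rcases hx with rfl | rfl | hx
      · rfl
      · rfl
      · exact h2 x (Or.inr hx)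
    · simp at hsum ⊢; omega
    · rw [← hprod]; simp; ring
    · rw [hsum] at h; simp at h ⊢; omega

theorem balancedMaps_nonempty (hk : 2 ≤ k) {J : Type*} [Fintype J] [DecidableEq J]
    (hJ : Fintype.card J = (k + 2) / 3) : (balancedMaps k J).Nonempty := by
  obtain ⟨s, h2, hsum, hprod, hcard⟩ := exists_isOptimal_card hk
  have hlen : s.toList.length = Fintype.card J := by rw [Multiset.length_toList, hcard, hJ]
  let g : J ≃ Fin s.toList.length := Fintype.equivOfCardEq (by rw [Fintype.card_fin, hlen])
  let a : J → ℕ := fun j => s.toList.get (g j)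
  have hasum : ∑ j, a j = k := by
    rw [Equiv.sum_comp g (fun i => s.toList.get i), ← List.sum_ofFn, List.ofFn_get,
      Multiset.sum_toList, hsum]
  have haprod : ∏ j, a j = maxProd k := by
    rw [Equiv.prod_comp g (fun i => s.toList.get i), ← List.prod_ofFn, List.ofFn_get,
      Multiset.prod_toList, hprod]
  let u : Fin k ≃ Σ j, Fin (a j) := Fintype.equivOfCardEq (by simp [hasum])
  have hfib : ∀ j, #{σ | (u σ).1 = j} = a j := by
    intro j
    have : ({σ | (u σ).1 = j} : Finset (Fin k)) =
        univ.image fun i : Fin (a j) => u.symm ⟨j, i⟩ := by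
      ext σ
      simp only [mem_filter, mem_univ, true_and, mem_image]
      constructor
      · rintro rfl
        exact ⟨(u σ).2, by simp⟩
      · rintro ⟨i, rfl⟩
        simp
    rw [this, card_image_of_injective, card_univ, Fintype.card_fin]
    intro i i' h
    simpa using h
  refine ⟨fun σ => (u σ).1, mem_filter.2 ⟨mem_univ _, fun j => ?_, ?_⟩⟩
  · rw [hfib]
    exact h2 _ (Multiset.mem_toList.1 (List.get_mem _ _))
  · simp_rw [hfib]
    exact haprod

end Splitting

/-! ### Counting r-sets: supersets, intersecting families, degrees -/

section SetCounting

variable {n : ℕ}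

/-- The number of `r`-sets containing a given set of at most `r` elements. -/
theorem card_filter_superset {r : ℕ} (u : Finset (Fin n)) (hu : #u ≤ r) :
    #{e ∈ powersetCard r (univ : Finset (Fin n)) | u ⊆ e} = (n - #u).choose (r - #u) := by
  have : #(powersetCard (r - #u) (univ \ u)) = (n - #u).choose (r - #u) := by
    rw [card_powersetCard, card_sdiff_of_subset (subset_univ u), card_univ, Fintype.card_fin]
  rw [← this]
  refine card_bij' (fun e _ => e \ u) (fun e _ => e ∪ u) ?_ ?_ ?_ ?_
  · intro e he
    obtain ⟨he, hue⟩ := mem_filter.1 he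
    refine mem_powersetCard.2 ⟨sdiff_subset_sdiff (subset_univ e) le_rfl, ?_⟩
    rw [card_sdiff_of_subset hue, (mem_powersetCard.1 he).2]
  · intro e he
    obtain ⟨he, hc⟩ := mem_powersetCard.1 he
    refine mem_filter.2 ⟨mem_powersetCard.2 ⟨subset_univ _, ?_⟩, subset_union_right⟩
    rw [card_union_of_disjoint, hc]
    · omega
    · exact disjoint_left.2 fun x hx => (mem_sdiff.1 (he hx)).2
  · intro e he
    exact sdiff_union_of_subset (mem_filter.1 he).2
  · intro e he
    refine union_sdiff_cancel_right ?_
    exact disjoint_left.2 fun x hx => (mem_sdiff.1 ((mem_powersetCard.1 he).1 hx)).2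

theorem card_filter_superset_le {r ℓ : ℕ} (hℓ : ℓ < r) (u : Finset (Fin n)) (hu : ℓ < #u) :
    #{e ∈ powersetCard r (univ : Finset (Fin n)) | u ⊆ e} ≤ n ^ (r - ℓ - 1) := by
  obtain ⟨v, hv, hc⟩ := exists_subset_card_eq (s := u) (n := ℓ + 1) hu
  calc _ ≤ #{e ∈ powersetCard r (univ : Finset (Fin n)) | v ⊆ e} :=
        card_le_card (monotone_filter_right _ fun e _ h => hv.trans h)
    _ = (n - (ℓ + 1)).choose (r - (ℓ + 1)) := by rw [card_filter_superset v (by omega), hc]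
    _ ≤ (n - (ℓ + 1)) ^ (r - (ℓ + 1)) := Nat.choose_le_pow _ _
    _ ≤ n ^ (r - (ℓ + 1)) := Nat.pow_le_pow_left (Nat.sub_le _ _) _
    _ = _ := by rw [Nat.sub_sub]

theorem card_filter_two_supersets_le {r ℓ : ℕ} (hℓ : ℓ < r) {s t : Finset (Fin n)}
    (hs : #s = ℓ) (ht : #t = ℓ) (hst : s ≠ t) :
    #{e ∈ powersetCard r (univ : Finset (Fin n)) | s ⊆ e ∧ t ⊆ e} ≤ n ^ (r - ℓ - 1) := by
  simp_rw [← union_subset_iff]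
  refine card_filter_superset_le hℓ _ ?_
  by_contra! h
  have h1 : s = s ∪ t := eq_of_subset_of_card_le subset_union_left (by omega)
  have h2 : t = s ∪ t := eq_of_subset_of_card_le subset_union_right (by omega)
  exact hst (h1.trans h2.symm)

/-- An `ℓ`-intersecting family of `r`-sets with no common `ℓ`-subset is small. -/
theorem card_le_of_intersecting {r ℓ : ℕ} (hℓ : ℓ < r) {F : Finset (Finset (Fin n))}
    (hF : F ⊆ powersetCard r univ) (hint : ∀ e ∈ F, ∀ f ∈ F, ℓ ≤ #(e ∩ f))
    (hns : ∀ t : Finset (Fin n), #t = ℓ → ∃ e ∈ F, ¬ t ⊆ e) :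
    #F ≤ 2 ^ r * r * n ^ (r - ℓ - 1) := by
  rcases F.eq_empty_or_nonempty with rfl | ⟨e₀, he₀⟩
  · simp
  have hcard : ∀ e ∈ F, #e = r := fun e he => (mem_powersetCard.1 (hF he)).2
  choose! g hgF hg using hns
  -- Each `f` in `F` shares an ℓ-set `t` with `e₀`. Some member `g t` of `F` does not contain `t`,
  -- yet meets `f` in at least ℓ points, so `f` also contains a point of `g t` outside `t`. This
  -- leaves at most 2^r choices of `t`, r of the extra point, and P of `f`.
  have hsub : F ⊆ (powersetCard ℓ e₀).biUnion fun t => (g t \ t).biUnion fun x =>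
      {e ∈ powersetCard r (univ : Finset (Fin n)) | insert x t ⊆ e} := by
    intro f hf
    obtain ⟨t, ht, hc⟩ := exists_subset_card_eq (hint f hf e₀ he₀)
    obtain ⟨x, hx⟩ : ((f ∩ g t) \ t).Nonempty := by
      rw [sdiff_nonempty]
      intro hsub
      have heq := eq_of_subset_of_card_le hsub (hc ▸ hint f hf _ (hgF t hc))
      have hsub' : f ∩ g t ⊆ g t := inter_subset_right
      rw [heq] at hsub'
      exact hg t hc hsub'
    simp only [mem_sdiff, mem_inter] at hx
    simp only [mem_biUnion, mem_filter, mem_sdiff, mem_powersetCard]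
    exact ⟨t, ⟨ht.trans inter_subset_right, hc⟩, x, ⟨hx.1.2, hx.2⟩,
      mem_powersetCard.1 (hF hf), insert_subset hx.1.1 (ht.trans inter_subset_left)⟩
  refine (card_le_card hsub).trans ?_
  refine (card_biUnion_le_card_mul _ _ (r * n ^ (r - ℓ - 1)) fun t ht => ?_).trans ?_
  · obtain ⟨-, hc⟩ := mem_powersetCard.1 ht
    refine (card_biUnion_le_card_mul _ _ (n ^ (r - ℓ - 1)) fun x hx => ?_).trans ?_
    · refine card_filter_superset_le hℓ _ ?_
      rw [card_insert_of_notMem (mem_sdiff.1 hx).2]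
      omega
    · refine Nat.mul_le_mul_right _ ?_
      exact (card_le_card sdiff_subset).trans (hcard _ (hgF t hc)).le
  · rw [mul_assoc]
    refine Nat.mul_le_mul_right _ ?_
    rw [card_powersetCard, hcard e₀ he₀]
    exact Nat.choose_le_two_pow _ _

/-- The number of members of `E` that contain `t`. -/
def degree (E : Finset (Finset (Fin n))) (t : Finset (Fin n)) : ℕ := #{e ∈ E | t ⊆ e}

theorem degree_le {r ℓ : ℕ} (hℓ : ℓ < r) {E : Finset (Finset (Fin n))}
    (hE : E ⊆ powersetCard r univ) {t : Finset (Fin n)} (ht : #t = ℓ) :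
    degree E t ≤ (n - ℓ).choose (r - ℓ) := by
  have := card_filter_superset t (ht.trans_le hℓ.le)
  rw [ht] at this
  rw [← this]
  exact card_le_card (filter_subset_filter _ hE)

theorem degree_powersetCard {r ℓ : ℕ} (hℓ : ℓ < r) {t : Finset (Fin n)} (ht : #t = ℓ) :
    degree (powersetCard r univ) t = (n - ℓ).choose (r - ℓ) := by
  have := card_filter_superset t (ht.trans_le hℓ.le)
  rwa [ht] at this

/-- The members of `E` that contain at least two members of `T`. -/
def doublyCovered (E T : Finset (Finset (Fin n))) : Finset (Finset (Fin n)) :=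
  {e ∈ E | ∃ s ∈ T, ∃ t ∈ T, s ≠ t ∧ s ⊆ e ∧ t ⊆ e}

theorem card_doublyCovered_le {r ℓ : ℕ} (hℓ : ℓ < r) {E T : Finset (Finset (Fin n))}
    (hE : E ⊆ powersetCard r univ) (hT : ∀ t ∈ T, #t = ℓ) :
    #(doublyCovered E T) ≤ #T * #T * n ^ (r - ℓ - 1) := by
  have hsub : doublyCovered E T ⊆ T.offDiag.biUnion fun p =>
      {e ∈ powersetCard r (univ : Finset (Fin n)) | p.1 ⊆ e ∧ p.2 ⊆ e} := by
    intro e he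
    obtain ⟨he, s, hs, t, ht, hne, hse, hte⟩ := mem_filter.1 he
    exact mem_biUnion.2 ⟨(s, t), mem_offDiag.2 ⟨hs, ht, hne⟩, mem_filter.2 ⟨hE he, hse, hte⟩⟩
  refine (card_le_card hsub).trans ((card_biUnion_le_card_mul _ _ (n ^ (r - ℓ - 1)) ?_).trans ?_)
  · intro p hp
    obtain ⟨h1, h2, h3⟩ := mem_offDiag.1 hp
    exact card_filter_two_supersets_le hℓ (hT _ h1) (hT _ h2) h3
  · refine Nat.mul_le_mul_right _ ?_
    rw [offDiag_card]
    exact Nat.sub_le _ _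

/-- The product of a weight over a family covered by `T` is controlled by the degrees of the
members of `T`. -/
theorem prod_weight_le {r ℓ k : ℕ} (hℓ : ℓ < r) (hk : 1 ≤ k) {E T : Finset (Finset (Fin n))}
    (hE : E ⊆ powersetCard r univ) (hT : ∀ t ∈ T, #t = ℓ) (hTk : #T ≤ k)
    (w b : Finset (Fin n) → ℕ) (hw : ∀ e ∈ E, w e ≤ k) (hb : ∀ t ∈ T, 1 ≤ b t)
    (hcover : ∀ e ∈ E, w e ≠ 0 → ∃ t ∈ T, t ⊆ e)
    (hwb : ∀ e ∈ E, ∀ t ∈ T, t ⊆ e → (∀ s ∈ T, s ⊆ e → s = t) → w e ≤ b t) :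
    ∏ e ∈ E, w e ≤ k ^ (k * k * n ^ (r - ℓ - 1)) * ∏ t ∈ T, b t ^ degree E t := by
  -- A member of `E` containing exactly one `t ∈ T` contributes at most `b t`. The few doubly
  -- covered ones are charged the trivial bound `k`.
  have hpoint : ∀ e ∈ E, w e ≤
      (if e ∈ doublyCovered E T then k else 1) * ∏ t ∈ T, if t ⊆ e then b t else 1 := by
    intro e he
    by_cases h0 : w e = 0
    · simp [h0]
    have hpos : 1 ≤ ∏ t ∈ T, if t ⊆ e then b t else 1 :=
      Nat.one_le_iff_ne_zero.2 (prod_ne_zero_iff.2 fun t ht => by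
        split_ifs
        · exact Nat.one_le_iff_ne_zero.1 (hb t ht)
        · exact one_ne_zero)
    split_ifs with hd
    · exact (hw e he).trans (Nat.le_mul_of_pos_right _ hpos)
    · obtain ⟨t, ht, hte⟩ := hcover e he h0
      have huniq : ∀ s ∈ T, s ⊆ e → s = t := by
        intro s hs hse
        by_contra hne
        exact hd (mem_filter.2 ⟨he, s, hs, t, ht, hne, hse, hte⟩)
      rw [one_mul, prod_eq_single_of_mem t ht fun s hs hne => if_neg fun hse =>
        hne (huniq s hs hse), if_pos hte]
      exact hwb e he t ht hte huniq
  refine (prod_le_prod' hpoint).trans ?_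
  rw [prod_mul_distrib]
  refine Nat.mul_le_mul ?_ ?_
  · rw [prod_ite, prod_const, prod_const_one, mul_one]
    refine Nat.pow_le_pow_right hk ?_
    calc _ ≤ #(doublyCovered E T) := card_le_card fun e he => (mem_filter.1 he).2
      _ ≤ _ := card_doublyCovered_le hℓ hE hT
      _ ≤ _ := Nat.mul_le_mul_right _ (Nat.mul_le_mul hTk hTk)
  · rw [prod_comm]
    refine (prod_congr rfl fun t _ => ?_).le
    rw [prod_ite, prod_const, prod_const_one, mul_one, degree]

end SetCounting

/-! ### The number of choices for a weighted family of centers -/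

section Choices

variable {n : ℕ}

/-- The sum of the weights `a i` over those `i` with `t i ⊆ e`. -/
def weight {J : Type*} [Fintype J] (a : J → ℕ) (t : J → Finset (Fin n)) (e : Finset (Fin n)) : ℕ :=
  ∑ i with t i ⊆ e, a i

/-- The number of ways to choose, for every `r`-set, a color available at it. -/
def choices (r : ℕ) {J : Type*} [Fintype J] (a : J → ℕ) (t : J → Finset (Fin n)) : ℕ :=
  ∏ e ∈ powersetCard r univ, max 1 (weight a t e)

theorem weight_comp {γ J : Type*} [Fintype γ] [Fintype J] [DecidableEq J] (α : γ → J)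
    (t : J → Finset (Fin n)) (e : Finset (Fin n)) :
    #{σ | (t ∘ α) σ ⊆ e} = weight (fun i => #{σ | α σ = i}) t e := by
  rw [weight, card_eq_sum_card_fiberwise (f := α) (t := {i | t i ⊆ e})]
  · refine sum_congr rfl fun i hi => ?_
    congr 1
    ext σ
    have := (mem_filter.1 hi).2
    simp only [mem_filter, mem_univ, true_and, Function.comp_apply, and_iff_right_iff_imp]
    rintro rfl
    exact this
  · intro σ hσ
    simpa using hσ

/-! ### Moving the centers apart -/

section Shift

variable {J : Type*} [Fintype J] [DecidableEq J]

/-- The two-term inequality behind the shift. -/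
theorem max_mul_max_le {a s s' : ℕ} (ha : 2 ≤ a) (hs : s = 0 ∨ 2 ≤ s) (hss : s' ≤ s) :
    max 1 (s + a) * max 1 s' ≤ max 1 s * max 1 (s' + a) := by
  rw [max_eq_right (by omega : 1 ≤ s + a), max_eq_right (by omega : 1 ≤ s' + a)]
  rcases Nat.eq_zero_or_pos s' with rfl | h'
  · rcases hs with rfl | hs
    · simp
    -- The claim is now `s + a ≤ s * a`. This is where weights of at least two are needed.
    · rw [max_eq_right (by omega : 1 ≤ s)]
      simp only [zero_le, sup_of_le_left, mul_one, zero_add]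
      nlinarith
  · rw [max_eq_right (by omega : 1 ≤ s), max_eq_right (by omega : 1 ≤ s')]
    nlinarith

theorem weight_eq_add (a : J → ℕ) (t : J → Finset (Fin n)) (i : J) (e : Finset (Fin n)) :
    weight a t e = (∑ j with j ≠ i ∧ t j ⊆ e, a j) + if t i ⊆ e then a i else 0 := by
  rw [weight, ← sum_filter_add_sum_filter_not _ (fun j => j ≠ i), filter_filter, filter_filter]
  congr 1
  · exact sum_congr (filter_congr fun j _ => and_comm) fun _ _ => rfl
  · simp only [not_not]
    split_ifs with h
    · rw [show ({j | t j ⊆ e ∧ j = i} : Finset J) = {i} by ext j; simp; rintro rfl; exact h,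
        sum_singleton]
    · rw [show ({j | t j ⊆ e ∧ j = i} : Finset J) = ∅ by ext j; simp; rintro h' rfl; exact h h',
        sum_empty]

/-- Replacing in one member `t i` a point `x` shared with another member by an unused point `y`
does not decrease the number of choices. -/
theorem choices_le_choices_update (r : ℕ) {a : J → ℕ} (ha : ∀ i, 2 ≤ a i)
    (t : J → Finset (Fin n)) {i : J} {x y : Fin n} (hxi : x ∈ t i) (hy : ∀ j, y ∉ t j) :
    choices r a t ≤ choices r a (Function.update t i (insert y ((t i).erase x))) := by
  set t' := Function.update t i (insert y ((t i).erase x)) with ht'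
  have hxy : x ≠ y := by rintro rfl; exact hy i hxi
  let τ : Equiv.Perm (Fin n) := Equiv.swap x y
  let rest : Finset (Fin n) → ℕ := fun e => ∑ j with j ≠ i ∧ t j ⊆ e, a j
  have hw : ∀ e, weight a t e = rest e + if t i ⊆ e then a i else 0 := weight_eq_add a t i
  have hw' : ∀ e, weight a t' e = rest e + if insert y ((t i).erase x) ⊆ e then a i else 0 := by
    intro e
    rw [weight_eq_add a t' i e]
    congr 1
    · refine sum_congr (filter_congr fun j _ => ?_) fun _ _ => rfl
      refine and_congr_right fun hj => ?_
      rw [ht', Function.update_of_ne hj]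
    · rw [ht', Function.update_self]
  let A : Finset (Finset (Fin n)) := {e ∈ powersetCard r univ | x ∈ e ∧ y ∉ e}
  let B : Finset (Finset (Fin n)) := {e ∈ powersetCard r univ | y ∈ e ∧ x ∉ e}
  let D : Finset (Finset (Fin n)) := {e ∈ powersetCard r univ | (x ∈ e ↔ y ∈ e)}
  have hAB : Disjoint A B := disjoint_left.2 fun e h1 h2 =>
    (mem_filter.1 h1).2.2 (mem_filter.1 h2).2.1
  have hABD : Disjoint (A ∪ B) D := by
    refine disjoint_left.2 fun e h1 h2 => ?_
    simp only [A, B, D, mem_union, mem_filter] at h1 h2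
    tauto
  have hU : powersetCard r univ = (A ∪ B) ∪ D := by
    ext e
    simp only [A, B, D, mem_union, mem_filter]
    tauto
  -- Exchanging `x` for `y` pairs `A` with `B`. Weights on `D` are unchanged by the shift, so it
  -- suffices to compare the products over the pairs.
  have hsplit : ∀ g : Finset (Fin n) → ℕ, ∏ e ∈ powersetCard r univ, g e =
      (∏ e ∈ A, g e * g (insert y (e.erase x))) * ∏ e ∈ D, g e := by
    intro g
    rw [hU, prod_union hABD, prod_union hAB, prod_mul_distrib]
    congr 2
    symm
    refine prod_bij' (fun e _ => insert y (e.erase x)) (fun e _ => insert x (e.erase y))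
      ?_ ?_ ?_ ?_ fun _ _ => rfl
    · intro e he
      simp only [A, B, mem_filter, mem_powersetCard, subset_univ, true_and] at he ⊢
      refine ⟨?_, mem_insert_self _ _, by simp [hxy]⟩
      rw [card_insert_of_notMem (by simp [he.2.2]), card_erase_of_mem he.2.1]
      have := card_pos.2 ⟨x, he.2.1⟩
      omega
    · intro e he
      simp only [A, B, mem_filter, mem_powersetCard, subset_univ, true_and] at he ⊢
      refine ⟨?_, mem_insert_self _ _, by simp [hxy.symm]⟩
      rw [card_insert_of_notMem (by simp [he.2.2]), card_erase_of_mem he.2.1]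
      have := card_pos.2 ⟨y, he.2.1⟩
      omega
    · intro e he
      simp only [A, mem_filter] at he
      rw [erase_insert (by simp [he.2.2]), insert_erase he.2.1]
    · intro e he
      simp only [B, mem_filter] at he
      rw [erase_insert (by simp [he.2.2]), insert_erase he.2.1]
  rw [choices, choices, hsplit, hsplit]
  refine Nat.mul_le_mul (prod_le_prod' fun e he => ?_) (prod_le_prod' fun e he => ?_)
  · simp only [A, mem_filter] at he
    obtain ⟨-, hxe, hye⟩ := he
    have h1 : ¬ insert y ((t i).erase x) ⊆ e := fun h => hye (h (mem_insert_self _ _))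
    have h2 : ¬ t i ⊆ insert y (e.erase x) := fun h => by
      have := h hxi
      simp [hxy] at this
    have h3 : insert y ((t i).erase x) ⊆ insert y (e.erase x) ↔ t i ⊆ e := by
      constructor
      · intro h z hz
        by_cases hzx : z = x
        · exact hzx ▸ hxe
        · have := h (mem_insert_of_mem (mem_erase.2 ⟨hzx, hz⟩))
          rcases mem_insert.1 this with rfl | h'
          · exact absurd hz (hy i)
          · exact mem_of_mem_erase h'
      · intro h
        exact insert_subset_insert _ (erase_subset_erase _ h)
    rw [hw, hw, hw', hw', if_neg h1, if_neg h2, if_congr h3 rfl rfl]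
    simp only [add_zero]
    split_ifs with h
    -- In the pair of `e` and its exchange, the shift moves the weight `a i` from the first set to
    -- the second. The other members contribute no more to the second set, because none of them
    -- contains `y`.
    · refine max_mul_max_le (ha i) ?_ ?_
      · by_cases hne : ({j | j ≠ i ∧ t j ⊆ e} : Finset J).Nonempty
        · obtain ⟨j, hj⟩ := hne
          exact Or.inr ((ha j).trans (single_le_sum (f := a) (fun _ _ => Nat.zero_le _) hj))
        · rw [not_nonempty_iff_eq_empty] at hne
          exact Or.inl (by simp only [rest]; rw [hne, sum_empty])
      · refine sum_le_sum_of_subset fun j hj => ?_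
        simp only [mem_filter, mem_univ, true_and] at hj ⊢
        refine ⟨hj.1, fun z hz => ?_⟩
        rcases mem_insert.1 (hj.2 hz) with rfl | h'
        · exact absurd hz (hy j)
        · exact mem_of_mem_erase h'
    · simp
  · simp only [D, mem_filter] at he
    have h3 : insert y ((t i).erase x) ⊆ e ↔ t i ⊆ e := by
      constructor
      · intro h z hz
        by_cases hzx : z = x
        · subst hzx
          exact he.2.2 (h (mem_insert_self _ _))
        · exact h (mem_insert_of_mem (mem_erase.2 ⟨hzx, hz⟩))
      · intro h
        exact insert_subset (he.2.1 (h hxi)) ((erase_subset _ _).trans h)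
    rw [hw, hw', if_congr h3 rfl rfl]

/-- Every family of `ℓ`-sets can be made disjoint without decreasing the number of choices. -/
theorem exists_disjoint_choices_le (r ℓ : ℕ) {a : J → ℕ} (ha : ∀ i, 2 ≤ a i)
    (hn : Fintype.card J * ℓ ≤ n) (t : J → Finset (Fin n)) (ht : ∀ i, #(t i) = ℓ) :
    ∃ t' : J → Finset (Fin n), (∀ i, #(t' i) = ℓ) ∧ Pairwise (Function.onFun Disjoint t') ∧
      choices r a t ≤ choices r a t' := by
  -- Each shift replaces a shared point by an unused one, so the union of the family grows.
  induction h : n - #(univ.biUnion t) using Nat.strong_induction_on generalizing t with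
  | _ m ih =>
    by_cases hd : Pairwise (Function.onFun Disjoint t)
    · exact ⟨t, ht, hd, le_rfl⟩
    have hnp : ∃ i j, i ≠ j ∧ ¬ Disjoint (t i) (t j) := by
      by_contra! hcon
      exact hd fun i j hij => hcon i j hij
    obtain ⟨i, j, hij, hnd⟩ := hnp
    obtain ⟨x, hxi, hxj⟩ := not_disjoint_iff.1 hnd
    -- The shared point `x` is counted twice in `Fintype.card J * ℓ`, so the union misses some point
    -- of the ground set.
    have hlt : #(univ.biUnion t) < n := by
      refine lt_of_lt_of_le ?_ hn
      have hsub : univ.biUnion t ⊆ (univ.erase i).biUnion t ∪ (t i).erase x := by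
        intro z hz
        obtain ⟨j', -, hz⟩ := mem_biUnion.1 hz
        by_cases hj' : j' = i
        · subst hj'
          by_cases hzx : z = x
          · subst hzx
            exact mem_union_left _ (mem_biUnion.2 ⟨j, mem_erase.2 ⟨hij.symm, mem_univ _⟩, hxj⟩)
          · exact mem_union_right _ (mem_erase.2 ⟨hzx, hz⟩)
        · exact mem_union_left _ (mem_biUnion.2 ⟨j', mem_erase.2 ⟨hj', mem_univ _⟩, hz⟩)
      have h1 := (card_le_card hsub).trans (card_union_le _ _)
      have h2 : #((univ.erase i).biUnion t) ≤ #(univ.erase i) * ℓ :=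
        card_biUnion_le_card_mul _ _ _ fun j _ => (ht j).le
      rw [card_erase_of_mem hxi, ht i] at h1
      rw [card_erase_of_mem (mem_univ i), card_univ] at h2
      have h3 : 0 < ℓ := ht i ▸ card_pos.2 ⟨x, hxi⟩
      have h4 : 0 < Fintype.card J := Fintype.card_pos_iff.2 ⟨i⟩
      obtain ⟨c, hc⟩ : ∃ c, Fintype.card J = c + 1 := ⟨_, (Nat.succ_pred_eq_of_pos h4).symm⟩
      rw [hc] at h2 ⊢
      rw [Nat.add_sub_cancel] at h2
      rw [add_mul, one_mul]
      omega
    obtain ⟨y, hy⟩ : ∃ y, y ∉ univ.biUnion t := by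
      by_contra! hcon
      rw [eq_univ_iff_forall.2 hcon, card_univ, Fintype.card_fin] at hlt
      exact lt_irrefl _ hlt
    have hy' : ∀ j, y ∉ t j := fun j hj => hy (mem_biUnion.2 ⟨j, mem_univ _, hj⟩)
    have hle := choices_le_choices_update r ha t hxi hy'
    set t₁ := Function.update t i (insert y ((t i).erase x)) with ht₁
    have hcard : ∀ j, #(t₁ j) = ℓ := by
      intro j'
      by_cases hj' : j' = i
      · subst hj'
        rw [ht₁, Function.update_self, card_insert_of_notMem (fun h => hy' _ (mem_of_mem_erase h)),
          card_erase_of_mem hxi, ht]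
        have : 0 < ℓ := ht j' ▸ card_pos.2 ⟨x, hxi⟩
        omega
      · rw [ht₁, Function.update_of_ne hj', ht]
    have hgrow : insert y (univ.biUnion t) ⊆ univ.biUnion t₁ := by
      refine insert_subset (mem_biUnion.2 ⟨i, mem_univ _, ?_⟩) fun z hz => ?_
      · rw [ht₁, Function.update_self]
        exact mem_insert_self _ _
      · obtain ⟨j', -, hz⟩ := mem_biUnion.1 hz
        by_cases hj' : j' = i
        · subst hj'
          by_cases hzx : z = x
          · subst hzx
            exact mem_biUnion.2 ⟨j, mem_univ _, by rwa [ht₁, Function.update_of_ne hij.symm]⟩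
          · refine mem_biUnion.2 ⟨j', mem_univ _, ?_⟩
            rw [ht₁, Function.update_self]
            exact mem_insert_of_mem (mem_erase.2 ⟨hzx, hz⟩)
        · exact mem_biUnion.2 ⟨j', mem_univ _, by rwa [ht₁, Function.update_of_ne hj']⟩
    have hgrow' := card_le_card hgrow
    rw [card_insert_of_notMem hy] at hgrow'
    obtain ⟨t', h1, h2, h3⟩ := ih _ (by omega) t₁ hcard rfl
    exact ⟨t', h1, h2, hle.trans h3⟩

end Shift

/-! ### Invariance under permutations of the ground set -/

section Permutation

variable {J : Type*} [Fintype J]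

/-- Two disjoint families of `ℓ`-sets are related by a permutation of the ground set. -/
theorem exists_perm_image_eq [DecidableEq J] {ℓ : ℕ} {t t' : J → Finset (Fin n)} (ht : ∀ i, #(t i) = ℓ)
    (ht' : ∀ i, #(t' i) = ℓ) (hd : Pairwise (Function.onFun Disjoint t))
    (hd' : Pairwise (Function.onFun Disjoint t')) :
    ∃ π : Equiv.Perm (Fin n), ∀ i, (t i).map π.toEmbedding = t' i := by
  let U : (t : J → Finset (Fin n)) → Pairwise (Function.onFun Disjoint t) →
      (Σ i, t i) ≃ {x // ∃ i, x ∈ t i} := fun t hd =>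
    Equiv.ofBijective (fun p => ⟨p.2, p.1, p.2.2⟩) (by
      constructor
      · rintro ⟨i, x, hx⟩ ⟨j, y, hy⟩ h
        have hxy : x = y := congrArg Subtype.val h
        subst hxy
        by_cases hij : i = j
        · subst hij; rfl
        · exact absurd hy (disjoint_left.1 (hd hij) hx)
      · rintro ⟨x, i, hx⟩
        exact ⟨⟨i, x, hx⟩, rfl⟩)
  let g : (Σ i, t i) ≃ (Σ i, t' i) := Equiv.sigmaCongrRight fun i =>
    Fintype.equivOfCardEq (by simp [ht, ht'])
  let e : {x // ∃ i, x ∈ t i} ≃ {x // ∃ i, x ∈ t' i} := ((U t hd).symm.trans g).trans (U t' hd')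
  refine ⟨e.extendSubtype, fun i => ?_⟩
  refine eq_of_subset_of_card_le ?_ (by rw [card_map, ht, ht'])
  intro y hy
  obtain ⟨x, hx, rfl⟩ := mem_map.1 hy
  have hU : (U t hd).symm ⟨x, i, hx⟩ = ⟨i, x, hx⟩ := by
    rw [Equiv.symm_apply_eq]
    rfl
  have : (e.extendSubtype x : Fin n) = e ⟨x, i, hx⟩ := e.extendSubtype_apply_of_mem x ⟨i, hx⟩
  change e.extendSubtype x ∈ t' i
  rw [this]
  simp only [e, Equiv.trans_apply, hU]
  exact (g ⟨i, x, hx⟩).2.2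

theorem choices_map (r : ℕ) (a : J → ℕ) (t : J → Finset (Fin n)) (π : Equiv.Perm (Fin n)) :
    choices r a (fun i => (t i).map π.toEmbedding) = choices r a t := by
  symm
  refine prod_bij' (fun e _ => e.map π.toEmbedding) (fun e _ => e.map π.symm.toEmbedding)
    ?_ ?_ ?_ ?_ ?_
  · intro e he
    simpa [mem_powersetCard] using he
  · intro e he
    simpa [mem_powersetCard] using he
  · intro e _
    ext x; simp
  · intro e _
    ext x; simp
  · intro e _
    simp only [weight, map_subset_map]

/-- A disjoint family of `ℓ`-sets has the largest number of choices. -/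
theorem choices_le_of_disjoint [DecidableEq J] (r ℓ : ℕ) {a : J → ℕ} (ha : ∀ i, 2 ≤ a i)
    (hn : Fintype.card J * ℓ ≤ n) {t u : J → Finset (Fin n)} (ht : ∀ i, #(t i) = ℓ)
    (hu : ∀ i, #(u i) = ℓ) (hd : Pairwise (Function.onFun Disjoint u)) :
    choices r a t ≤ choices r a u := by
  obtain ⟨t', h1, h2, h3⟩ := exists_disjoint_choices_le r ℓ ha hn t ht
  obtain ⟨π, hπ⟩ := exists_perm_image_eq h1 hu h2 hd
  have := choices_map r a t' π
  rw [funext hπ] at this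
  rw [this]
  exact h3

end Permutation

end Choices

/-! ### Star colorings, non-star colorings and a first upper bound -/

section Colorings

variable {n k : ℕ}

/-- The Kneser colorings of the family `E` with colors from `M`, as partial maps with
domain `E`. -/
def colorings (ℓ : ℕ) (E : Finset (Finset (Fin n))) (M : Finset (Fin k)) :
    Finset (Finset (Fin n) → Option (Fin k)) :=
  {Δ ∈ Fintype.piFinset fun e => if e ∈ E then M.image some else {none} |
    ∀ e ∈ E, ∀ f ∈ E, e ≠ f → Δ e = Δ f → ℓ ≤ #(e ∩ f)}

/-- The maps that color each `e ∈ E` with a color from `M` whose center is contained in `e`. -/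
def starColorings (φ : Fin k → Finset (Fin n)) (E : Finset (Finset (Fin n)))
    (M : Finset (Fin k)) : Finset (Finset (Fin n) → Option (Fin k)) :=
  Fintype.piFinset fun e => if e ∈ E then {σ ∈ M | φ σ ⊆ e}.image some else {none}

theorem mem_colorings {ℓ : ℕ} {E : Finset (Finset (Fin n))} {M : Finset (Fin k)}
    {Δ : Finset (Fin n) → Option (Fin k)} :
    Δ ∈ colorings ℓ E M ↔ (∀ e ∈ E, ∃ σ ∈ M, Δ e = some σ) ∧ (∀ e ∉ E, Δ e = none) ∧
      ∀ e ∈ E, ∀ f ∈ E, e ≠ f → Δ e = Δ f → ℓ ≤ #(e ∩ f) := by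
  rw [colorings, mem_filter, Fintype.mem_piFinset, ← and_assoc]
  refine and_congr_left fun _ => ⟨fun h => ⟨fun e he => ?_, fun e he => ?_⟩, fun h e => ?_⟩
  · have := h e
    rw [if_pos he] at this
    obtain ⟨σ, hσ, h⟩ := mem_image.1 this
    exact ⟨σ, hσ, h.symm⟩
  · have := h e
    rw [if_neg he] at this
    exact mem_singleton.1 this
  · split_ifs with he
    · obtain ⟨σ, hσ, h'⟩ := h.1 e he
      exact mem_image.2 ⟨σ, hσ, h'.symm⟩
    · exact mem_singleton.2 (h.2 e he)

theorem mem_starColorings {φ : Fin k → Finset (Fin n)} {E : Finset (Finset (Fin n))}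
    {M : Finset (Fin k)} {Δ : Finset (Fin n) → Option (Fin k)} :
    Δ ∈ starColorings φ E M ↔ (∀ e ∈ E, ∃ σ ∈ M, φ σ ⊆ e ∧ Δ e = some σ) ∧
      ∀ e ∉ E, Δ e = none := by
  rw [starColorings, Fintype.mem_piFinset]
  refine ⟨fun h => ⟨fun e he => ?_, fun e he => ?_⟩, fun h e => ?_⟩
  · have := h e
    rw [if_pos he] at this
    obtain ⟨σ, hσ, h⟩ := mem_image.1 this
    exact ⟨σ, (mem_filter.1 hσ).1, (mem_filter.1 hσ).2, h.symm⟩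
  · have := h e
    rw [if_neg he] at this
    exact mem_singleton.1 this
  · split_ifs with he
    · obtain ⟨σ, hσ, h1, h'⟩ := h.1 e he
      exact mem_image.2 ⟨σ, mem_filter.2 ⟨hσ, h1⟩, h'.symm⟩
    · exact mem_singleton.2 (h.2 e he)

theorem card_starColorings (φ : Fin k → Finset (Fin n)) (E : Finset (Finset (Fin n)))
    (M : Finset (Fin k)) : #(starColorings φ E M) = ∏ e ∈ E, #{σ ∈ M | φ σ ⊆ e} := by
  rw [starColorings, Fintype.card_piFinset, ← prod_subset (subset_univ E)]
  · refine prod_congr rfl fun e he => ?_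
    rw [if_pos he, card_image_of_injective _ (Option.some_injective _)]
  · intro e _ he
    rw [if_neg he, card_singleton]

/-- A hyperedge containing only one center `t` can use only the colors centered at `t`, so
`prod_weight_le` applies with the fiber sizes as bounds. -/
theorem card_starColorings_le {r ℓ : ℕ} (hℓ : ℓ < r) (hk : 1 ≤ k) {φ : Fin k → Finset (Fin n)}
    (hφ : ∀ σ, #(φ σ) = ℓ) {E : Finset (Finset (Fin n))} (hE : E ⊆ powersetCard r univ)
    (M : Finset (Fin k)) :
    #(starColorings φ E M) ≤ k ^ (k * k * n ^ (r - ℓ - 1)) *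
      ∏ t ∈ M.image φ, #{σ ∈ M | φ σ = t} ^ degree E t := by
  have hMk : #M ≤ k := by simpa using card_le_univ M
  rw [card_starColorings]
  refine prod_weight_le hℓ hk hE ?_ (card_image_le.trans hMk) _ _
    (fun e _ => (card_filter_le _ _).trans hMk) ?_ ?_ ?_
  · intro t ht
    obtain ⟨σ, -, rfl⟩ := mem_image.1 ht
    exact hφ σ
  · intro t ht
    obtain ⟨σ, hσ, rfl⟩ := mem_image.1 ht
    exact card_pos.2 ⟨σ, mem_filter.2 ⟨hσ, rfl⟩⟩
  · intro e _ h
    obtain ⟨σ, hσ⟩ := card_pos.1 (Nat.pos_of_ne_zero h)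
    exact ⟨φ σ, mem_image_of_mem _ (mem_filter.1 hσ).1, (mem_filter.1 hσ).2⟩
  · intro e _ t _ _ huniq
    refine card_le_card fun σ hσ => ?_
    obtain ⟨h1, h2⟩ := mem_filter.1 hσ
    exact mem_filter.2 ⟨h1, huniq _ (mem_image_of_mem _ h1) h2⟩

/-- The colorings with a color class that has no common `ℓ`-subset. -/
def nonStarColorings (ℓ : ℕ) (E : Finset (Finset (Fin n))) (M : Finset (Fin k)) :
    Finset (Finset (Fin n) → Option (Fin k)) :=
  {Δ ∈ colorings ℓ E M |
    ∃ σ ∈ M, ∀ t : Finset (Fin n), #t = ℓ → ∃ e ∈ E, Δ e = some σ ∧ ¬ t ⊆ e}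

/-- If every color class is a star, choosing a center for each color exhibits the coloring as a star
coloring. The hypothesis `ℓ ≤ n` provides a dummy center for the colors outside `M`. -/
theorem colorings_subset {ℓ : ℕ} (hn : ℓ ≤ n) (E : Finset (Finset (Fin n)))
    (M : Finset (Fin k)) :
    colorings ℓ E M ⊆ ((Fintype.piFinset fun _ : Fin k => powersetCard ℓ univ).biUnion
      fun φ => starColorings φ E M) ∪ nonStarColorings ℓ E M := by
  intro Δ hΔ
  by_cases h : Δ ∈ nonStarColorings ℓ E M
  · exact mem_union_right _ h
  refine mem_union_left _ ?_
  have h' : ∀ σ, ∃ t : Finset (Fin n), #t = ℓ ∧ (σ ∈ M → ∀ e ∈ E, Δ e = some σ → t ⊆ e) := by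
    intro σ
    by_cases hσ : σ ∈ M
    · by_contra! hcon
      refine h (mem_filter.2 ⟨hΔ, σ, hσ, fun t ht => ?_⟩)
      obtain ⟨-, e, he, h1, h2⟩ := hcon t ht
      exact ⟨e, he, h1, h2⟩
    · obtain ⟨t, -, ht⟩ := exists_subset_card_eq (s := (univ : Finset (Fin n))) (n := ℓ) (by simpa)
      exact ⟨t, ht, fun h => absurd h hσ⟩
  choose φ hφ hφ' using h'
  obtain ⟨h1, h2, -⟩ := mem_colorings.1 hΔ
  refine mem_biUnion.2 ⟨φ, ?_, mem_starColorings.2 ⟨fun e he => ?_, h2⟩⟩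
  · exact Fintype.mem_piFinset.2 fun σ => mem_powersetCard.2 ⟨subset_univ _, hφ σ⟩
  · obtain ⟨σ, hσ, hσe⟩ := h1 e he
    exact ⟨σ, hσ, hφ' σ hσ e he hσe, hσe⟩

theorem card_filter_powerset_le {X : Type*} (S : Finset X) (L : ℕ) :
    #{F ∈ S.powerset | #F ≤ L} ≤ (#S + 1) ^ L := by
  have h : ∀ L, ∑ i ∈ range (L + 1), #S ^ i ≤ (#S + 1) ^ L := by
    intro L
    induction L with
    | zero => simp
    | succ L ih =>
      rw [sum_range_succ, pow_succ (#S + 1), mul_add, mul_one, add_comm, pow_succ]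
      exact Nat.add_le_add (Nat.mul_le_mul_right _ (Nat.pow_le_pow_left (Nat.le_succ _) _)) ih
  classical
  refine le_trans ?_ (h L)
  calc #{F ∈ S.powerset | #F ≤ L}
      ≤ #((range (L + 1)).biUnion fun i => powersetCard i S) := card_le_card fun F hF => by
        obtain ⟨h1, h2⟩ := mem_filter.1 hF
        exact mem_biUnion.2 ⟨#F, mem_range.2 (by omega),
          mem_powersetCard.2 ⟨mem_powerset.1 h1, rfl⟩⟩
    _ ≤ ∑ i ∈ range (L + 1), #(powersetCard i S) := card_biUnion_le
    _ ≤ _ := sum_le_sum fun i _ => by rw [card_powersetCard]; exact Nat.choose_le_pow _ _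

/-- A coloring with a non-star class is determined by the color of that class, the class itself, and
a coloring of the remaining hyperedges without that color. The class has at most `L` members among
at most n^r sets, hence at most (n + 1)^(rL) possibilities. -/
theorem card_nonStarColorings_le {r ℓ : ℕ} (hℓ : ℓ < r) {E : Finset (Finset (Fin n))}
    (hE : E ⊆ powersetCard r univ) (M : Finset (Fin k)) (D : ℕ)
    (hD : ∀ E' : Finset (Finset (Fin n)), E' ⊆ powersetCard r univ → ∀ σ ∈ M, #(colorings ℓ E' (M.erase σ)) ≤ D) :
    #(nonStarColorings ℓ E M) ≤ k * ((n + 1) ^ (r * (2 ^ r * r * n ^ (r - ℓ - 1))) * D) := by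
  set L := 2 ^ r * r * n ^ (r - ℓ - 1) with hL
  have hsub : nonStarColorings ℓ E M ⊆ M.biUnion fun σ =>
      ({F ∈ (powersetCard r (univ : Finset (Fin n))).powerset | #F ≤ L}).biUnion fun F =>
        (colorings ℓ (E \ F) (M.erase σ)).image fun Δ e => if e ∈ F then some σ else Δ e := by
    intro Δ hΔ
    obtain ⟨hΔ, σ, hσ, hns⟩ := mem_filter.1 hΔ
    obtain ⟨h1, h2, h3⟩ := mem_colorings.1 hΔ
    have hF : {e ∈ E | Δ e = some σ} ⊆ powersetCard r univ := (filter_subset _ _).trans hE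
    refine mem_biUnion.2 ⟨σ, hσ, mem_biUnion.2 ⟨{e ∈ E | Δ e = some σ}, ?_, ?_⟩⟩
    · refine mem_filter.2 ⟨mem_powerset.2 hF, ?_⟩
      refine card_le_of_intersecting hℓ hF ?_ ?_
      · intro e he f hf
        obtain ⟨he, hce⟩ := mem_filter.1 he
        obtain ⟨hf, hcf⟩ := mem_filter.1 hf
        by_cases hef : e = f
        · rw [← hef, inter_self, (mem_powersetCard.1 (hE he)).2]
          exact hℓ.le
        · exact h3 e he f hf hef (hce.trans hcf.symm)
      · intro t ht
        obtain ⟨e, he, hc, hte⟩ := hns t ht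
        exact ⟨e, mem_filter.2 ⟨he, hc⟩, hte⟩
    · refine mem_image.2 ⟨fun e => if e ∈ ({e ∈ E | Δ e = some σ} : Finset _) then none else Δ e,
        mem_colorings.2 ⟨?_, ?_, ?_⟩, ?_⟩
      · intro e he
        obtain ⟨he', hne⟩ := mem_sdiff.1 he
        obtain ⟨τ, hτ, hc⟩ := h1 e he'
        refine ⟨τ, mem_erase.2 ⟨?_, hτ⟩, by rw [if_neg hne, hc]⟩
        rintro rfl
        exact hne (mem_filter.2 ⟨he', hc⟩)
      · intro e he
        by_cases h : e ∈ ({e ∈ E | Δ e = some σ} : Finset _)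
        · exact if_pos h
        · exact (if_neg h).trans (h2 e fun he' => he (mem_sdiff.2 ⟨he', h⟩))
      · intro e he f hf hef hc
        obtain ⟨he, hne⟩ := mem_sdiff.1 he
        obtain ⟨hf, hnf⟩ := mem_sdiff.1 hf
        simp only [if_neg hne, if_neg hnf] at hc
        exact h3 e he f hf hef hc
      · funext e
        split_ifs with h
        · exact (mem_filter.1 h).2.symm
        · exact if_neg h
  refine (card_le_card hsub).trans ?_
  refine (card_biUnion_le_card_mul _ _ ((n + 1) ^ (r * L) * D) fun σ hσ => ?_).trans ?_
  · refine (card_biUnion_le_card_mul _ _ D fun F _ => ?_).trans (Nat.mul_le_mul_right _ ?_)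
    · exact card_image_le.trans (hD _ (sdiff_subset.trans hE) σ hσ)
    · refine (card_filter_powerset_le _ _).trans ?_
      rw [pow_mul (n + 1) r L]
      refine Nat.pow_le_pow_left ?_ L
      rw [card_powersetCard, card_univ, Fintype.card_fin]
      calc n.choose r + 1 ≤ n ^ r + 1 := Nat.add_le_add_right (Nat.choose_le_pow _ _) _
        _ ≤ (n + 1) ^ r := by
          obtain ⟨q, rfl⟩ : ∃ q, r = q + 1 := ⟨r - 1, by omega⟩
          have h1 : n ^ q ≤ (n + 1) ^ q := Nat.pow_le_pow_left (Nat.le_succ _) _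
          have h2 : 1 ≤ (n + 1) ^ q := Nat.one_le_pow _ _ (Nat.succ_pos _)
          rw [pow_succ, pow_succ]
          nlinarith
  · exact Nat.mul_le_mul_right _ (by simpa using card_le_univ M)

theorem card_centers_le {ℓ : ℕ} (n k : ℕ) :
    #(Fintype.piFinset fun _ : Fin k => powersetCard ℓ (univ : Finset (Fin n))) ≤ n ^ (ℓ * k) := by
  rw [Fintype.card_piFinset_const, card_powersetCard, card_univ, Fintype.card_fin, pow_mul]
  exact Nat.pow_le_pow_left (Nat.choose_le_pow _ _) _

theorem prod_fiber_pow_degree_le {r ℓ : ℕ} (hℓ : ℓ < r) {φ : Fin k → Finset (Fin n)}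
    (hφ : ∀ σ, #(φ σ) = ℓ) {E : Finset (Finset (Fin n))} (hE : E ⊆ powersetCard r univ)
    (M : Finset (Fin k)) :
    ∏ t ∈ M.image φ, #{σ ∈ M | φ σ = t} ^ degree E t ≤
      (∏ t ∈ M.image φ, #{σ ∈ M | φ σ = t}) ^ (n - ℓ).choose (r - ℓ) := by
  rw [← prod_pow]
  refine prod_le_prod' fun t ht => ?_
  obtain ⟨σ, hσ, rfl⟩ := mem_image.1 ht
  refine Nat.pow_le_pow_right (card_pos.2 ⟨σ, ?_⟩) (degree_le hℓ hE (hφ σ))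
  exact mem_filter.2 ⟨hσ, rfl⟩

/-- The exponent of the error factor lost for every color. -/
def errorExponent (r ℓ k : ℕ) : ℕ := ℓ * k + k * k + r * (2 ^ r * r) + 2

/-- An upper bound for the number of Kneser colorings that is sharp up to lower order terms in
the exponent. -/
theorem card_colorings_le {r ℓ : ℕ} (hℓ : ℓ < r) (hk : 1 ≤ k) (hn : r ≤ n)
    (M : Finset (Fin k)) {E : Finset (Finset (Fin n))} (hE : E ⊆ powersetCard r univ) :
    #(colorings ℓ E M) ≤
      (n + k + 1) ^ (errorExponent r ℓ k * (#M + 1) * n ^ (r - ℓ - 1)) *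
        maxProd #M ^ (n - ℓ).choose (r - ℓ) := by
  induction h : #M generalizing M E with
  | zero =>
    rw [card_eq_zero] at h
    subst h
    have : colorings ℓ E (∅ : Finset (Fin k)) ⊆ {fun _ => none} := by
      intro Δ hΔ
      obtain ⟨h1, h2, -⟩ := mem_colorings.1 hΔ
      refine mem_singleton.2 (funext fun e => ?_)
      by_cases he : e ∈ E
      · obtain ⟨σ, hσ, -⟩ := h1 e he
        simp at hσ
      · exact h2 e he
    refine (card_le_card this).trans ?_
    rw [card_singleton]
    exact Nat.mul_pos (Nat.pow_pos (by omega)) (Nat.pow_pos (maxProd_pos _))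
  | succ m ih =>
    set P := n ^ (r - ℓ - 1) with hP
    set N := (n - ℓ).choose (r - ℓ) with hN
    set B := n + k + 1 with hB
    set K := errorExponent r ℓ k with hK
    have hP1 : 1 ≤ P := Nat.one_le_pow _ _ (by omega)
    have hB2 : 2 ≤ B := by omega
    have hB1 : 1 ≤ B := by omega
    -- Both the star and the non-star part are bounded with one factor `B` to spare in the exponent.
    -- Their sum costs a factor 2 ≤ `B`, which uses it up.
    have hstar : #((Fintype.piFinset fun _ : Fin k => powersetCard ℓ univ).biUnion
        fun φ => starColorings φ E M) ≤ B ^ (K * (m + 1 + 1) * P - 1) * maxProd (m + 1) ^ N := by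
      refine (card_biUnion_le_card_mul _ _ (B ^ (k * k * P) * maxProd (m + 1) ^ N)
        fun φ hφ => ?_).trans ?_
      · have hφ' : ∀ σ, #(φ σ) = ℓ := fun σ =>
          (mem_powersetCard.1 (Fintype.mem_piFinset.1 hφ σ)).2
        refine (card_starColorings_le hℓ hk hφ' hE M).trans (Nat.mul_le_mul ?_ ?_)
        · exact Nat.pow_le_pow_left (by omega) _
        · refine (prod_fiber_pow_degree_le hℓ hφ' hE M).trans (Nat.pow_le_pow_left ?_ _)
          rw [← h]
          exact prod_card_fiber_le M φ
      · rw [← mul_assoc]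
        refine Nat.mul_le_mul_right _ ?_
        calc _ ≤ B ^ (ℓ * k) * B ^ (k * k * P) := Nat.mul_le_mul_right _
              ((card_centers_le n k).trans (Nat.pow_le_pow_left (by omega) _))
          _ = B ^ (ℓ * k + k * k * P) := (pow_add _ _ _).symm
          _ ≤ _ := by
            refine Nat.pow_le_pow_right hB1 (Nat.le_sub_one_of_lt ?_)
            have h1 : ℓ * k ≤ ℓ * k * P := Nat.le_mul_of_pos_right _ hP1
            have h2 : (ℓ * k + k * k + 2) * P ≤ K * (m + 1 + 1) * P := by
              refine Nat.mul_le_mul_right _ ?_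
              refine le_trans ?_ (Nat.le_mul_of_pos_right K (by omega))
              rw [hK, errorExponent]
              omega
            nlinarith
    have hnon : #(nonStarColorings ℓ E M) ≤
        B ^ (K * (m + 1 + 1) * P - 1) * maxProd (m + 1) ^ N := by
      refine (card_nonStarColorings_le hℓ hE M (B ^ (K * (m + 1) * P) * maxProd m ^ N)
        fun E' hE' σ hσ => ih (M.erase σ) hE' (by rw [card_erase_of_mem hσ, h]; rfl)).trans ?_
      rw [← mul_assoc, ← mul_assoc]
      refine Nat.mul_le_mul ?_ (Nat.pow_le_pow_left (maxProd_mono (Nat.le_succ m)) _)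
      calc _ ≤ B ^ 1 * B ^ (r * (2 ^ r * r * P)) * B ^ (K * (m + 1) * P) := by
            refine Nat.mul_le_mul_right _ (Nat.mul_le_mul (by rw [pow_one]; omega) ?_)
            exact Nat.pow_le_pow_left (by omega) _
        _ = B ^ (1 + r * (2 ^ r * r * P) + K * (m + 1) * P) := by rw [← pow_add, ← pow_add]
        _ ≤ _ := by
          refine Nat.pow_le_pow_right hB1 (Nat.le_sub_one_of_lt ?_)
          have h2 : (r * (2 ^ r * r) + 2) * P ≤ K * P := by
            refine Nat.mul_le_mul_right _ ?_
            rw [hK, errorExponent]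
            omega
          have h3 : K * (m + 1 + 1) * P = K * (m + 1) * P + K * P := by ring
          rw [h3]
          nlinarith
    have hKpos : 1 ≤ K * (m + 1 + 1) * P := Nat.mul_pos (Nat.mul_pos (by
      rw [hK, errorExponent]; omega) (by omega)) hP1
    refine (card_le_card (colorings_subset (by omega) E M)).trans
      ((card_union_le _ _).trans ((Nat.add_le_add hstar hnon).trans ?_))
    rw [← two_mul, ← mul_assoc]
    refine Nat.mul_le_mul_right _ ?_
    calc _ ≤ B * B ^ (K * (m + 1 + 1) * P - 1) := Nat.mul_le_mul_right _ hB2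
      _ = _ := by rw [← pow_succ', Nat.sub_add_cancel hKpos]

end Colorings

/-! ### The sharp upper bound: discarding negligible assignments of centers -/

section UpperBound

variable {n k : ℕ}

/-- A contraction rate that beats both a suboptimal distribution of the colors and a center of
small degree. -/
def IsRate (k : ℕ) (x : ℝ) : Prop :=
  0 < x ∧ x < 1 ∧ (maxProd k : ℝ) - 1 ≤ x * maxProd k ∧ 1 / 2 ≤ x ^ 2

theorem exists_isRate (k : ℕ) : ∃ x, IsRate k x := by
  have hf : (0 : ℝ) < maxProd k := by exact_mod_cast maxProd_pos k
  -- The bound 3/4 gives x² ≥ 1/2, and 1 - 1/maxProd(k) covers every integer below maxProd(k).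
  refine ⟨max (3 / 4) (1 - 1 / maxProd k), by positivity, ?_, ?_, ?_⟩
  · refine max_lt (by norm_num) ?_
    have : (0 : ℝ) < 1 / maxProd k := by positivity
    linarith
  · have h := mul_le_mul_of_nonneg_right (le_max_right (3 / 4 : ℝ) (1 - 1 / maxProd k)) hf.le
    have h' : (1 - 1 / (maxProd k : ℝ)) * maxProd k = maxProd k - 1 := by field_simp
    linarith
  · have := le_max_left (3 / 4 : ℝ) (1 - 1 / maxProd k)
    nlinarith

theorem IsRate.pow_le_of_lt {x : ℝ} (hx : IsRate k x) {m : ℕ} (hm : m < maxProd k) (N : ℕ) :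
    ((m ^ N : ℕ) : ℝ) ≤ (x * maxProd k) ^ N := by
  rw [Nat.cast_pow]
  refine pow_le_pow_left₀ (Nat.cast_nonneg _) (le_trans ?_ hx.2.2.1) _
  have : (m : ℝ) + 1 ≤ maxProd k := by exact_mod_cast hm
  linarith

/-- More than half of the `N` factors `a ≥ 2` are missing on the left. Each missing factor pays for
two factors of `x`, since 2x² ≥ 1. -/
theorem IsRate.pow_le_pow_mul {x : ℝ} (hx : IsRate k x) {a d N : ℕ} (ha : 2 ≤ a)
    (hd : 2 * d < N) : (a : ℝ) ^ d ≤ a ^ N * x ^ N := by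
  obtain ⟨q, rfl⟩ : ∃ q, N = d + q := ⟨N - d, by omega⟩
  have h1 : (1 : ℝ) ≤ a ^ q * x ^ (d + q) := by
    calc (1 : ℝ) = 2 ^ q * (1 / 2) ^ q := by rw [← mul_pow]; norm_num
      _ ≤ a ^ q * (x ^ 2) ^ q := by
        refine mul_le_mul (pow_le_pow_left₀ (by norm_num) (by exact_mod_cast ha) _)
          (pow_le_pow_left₀ (by norm_num) hx.2.2.2 _) (by positivity) (by positivity)
      _ ≤ a ^ q * x ^ (d + q) := by
        refine mul_le_mul_of_nonneg_left ?_ (by positivity)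
        rw [← pow_mul]
        exact pow_le_pow_of_le_one hx.1.le hx.2.1.le (by omega)
  calc (a : ℝ) ^ d = a ^ d * 1 := (mul_one _).symm
    _ ≤ a ^ d * (a ^ q * x ^ (d + q)) := mul_le_mul_of_nonneg_left h1 (by positivity)
    _ = _ := by rw [pow_add]; ring

theorem IsRate.prod_pow_le {x : ℝ} (hx : IsRate k x) {X : Type*} {S : Finset X} {a d : X → ℕ}
    {N : ℕ} {t₀ : X} (ht₀ : t₀ ∈ S) (ha₀ : 2 ≤ a t₀) (hd₀ : 2 * d t₀ < N) (ha : ∀ t ∈ S, 1 ≤ a t)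
    (hd : ∀ t ∈ S, d t ≤ N) :
    ((∏ t ∈ S, a t ^ d t : ℕ) : ℝ) ≤ (x * (∏ t ∈ S, a t : ℕ)) ^ N := by
  classical
  have hx0 := hx.1
  rw [← mul_prod_erase S _ ht₀, ← mul_prod_erase S a ht₀, Nat.cast_mul, Nat.cast_mul, mul_pow,
    mul_pow, ← mul_assoc, mul_comm (x ^ N)]
  refine mul_le_mul ?_ ?_ (by positivity) (by positivity)
  · rw [Nat.cast_pow]
    exact hx.pow_le_pow_mul ha₀ hd₀
  · rw [← Nat.cast_pow, Nat.cast_le, ← prod_pow]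
    exact prod_le_prod' fun t ht =>
      Nat.pow_le_pow_right (ha t (mem_of_mem_erase ht)) (hd t (mem_of_mem_erase ht))

/-- The `ℓ`-sets contained in at least half as many members of `E` as possible. -/
def heavySets (r ℓ : ℕ) (E : Finset (Finset (Fin n))) : Finset (Finset (Fin n)) :=
  {t ∈ powersetCard ℓ univ | (n - ℓ).choose (r - ℓ) ≤ 2 * degree E t}

/-- As a star coloring exists, every hyperedge contains a center. An ℓ-set that is not a center
therefore lies only in hyperedges containing it and one of at most `k` other ℓ-sets. There are at
most kP of these, fewer than N/2, so every heavy set is a center. -/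
theorem mem_optimalMaps_of_heavy {r ℓ : ℕ} (hℓ : ℓ < r)
    (hN : 2 * (k * n ^ (r - ℓ - 1)) < (n - ℓ).choose (r - ℓ)) {φ : Fin k → Finset (Fin n)}
    (hφ : ∀ σ, #(φ σ) = ℓ) {E : Finset (Finset (Fin n))} (hE : E ⊆ powersetCard r univ)
    (hne : (starColorings φ E univ).Nonempty)
    (hopt : ∏ t ∈ univ.image φ, #{σ | φ σ = t} = maxProd k)
    (hheavy : ∀ σ, (n - ℓ).choose (r - ℓ) ≤ 2 * degree E (φ σ)) :
    φ ∈ optimalMaps k (heavySets r ℓ E) := by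
  have himage : univ.image φ = heavySets r ℓ E := by
    refine Subset.antisymm (fun t ht => ?_) (fun t ht => ?_)
    · obtain ⟨σ, -, rfl⟩ := mem_image.1 ht
      exact mem_filter.2 ⟨mem_powersetCard.2 ⟨subset_univ _, hφ σ⟩, hheavy σ⟩
    · by_contra hnot
      obtain ⟨htℓ, ht⟩ := mem_filter.1 ht
      obtain ⟨Δ, hΔ⟩ := hne
      have hsub : {e ∈ E | t ⊆ e} ⊆ (univ : Finset (Fin k)).biUnion fun σ =>
          {e ∈ powersetCard r (univ : Finset (Fin n)) | φ σ ⊆ e ∧ t ⊆ e} := by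
        intro e he
        obtain ⟨he, hte⟩ := mem_filter.1 he
        obtain ⟨σ, -, hσ, -⟩ := (mem_starColorings.1 hΔ).1 e he
        exact mem_biUnion.2 ⟨σ, mem_univ _, mem_filter.2 ⟨hE he, hσ, hte⟩⟩
      have h1 : degree E t ≤ k * n ^ (r - ℓ - 1) := by
        refine (card_le_card hsub).trans ((card_biUnion_le_card_mul _ _ _ fun σ _ =>
          card_filter_two_supersets_le hℓ (hφ σ) (mem_powersetCard.1 htℓ).2 ?_).trans ?_)
        · rintro rfl
          exact hnot (mem_image_of_mem _ (mem_univ _))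
        · rw [card_univ, Fintype.card_fin]
      omega
  exact ⟨himage, himage ▸ hopt⟩

/-- Unless there are no star colorings, either the fiber sizes are suboptimal, which lowers the base
of the power, or some center has degree below N/2, which lowers its exponent. Both cost a factor
x^N. -/
theorem card_starColorings_le_of_notMem {r ℓ : ℕ} (hℓ : ℓ < r) (hk : 2 ≤ k)
    (hN : 2 * (k * n ^ (r - ℓ - 1)) < (n - ℓ).choose (r - ℓ)) {x : ℝ} (hx : IsRate k x)
    {φ : Fin k → Finset (Fin n)}
    (hφ : ∀ σ, #(φ σ) = ℓ) {E : Finset (Finset (Fin n))} (hE : E ⊆ powersetCard r univ)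
    (hnot : φ ∉ optimalMaps k (heavySets r ℓ E)) :
    (#(starColorings φ E univ) : ℝ) ≤ (k : ℝ) ^ (k * k * n ^ (r - ℓ - 1)) *
      (x * maxProd k) ^ (n - ℓ).choose (r - ℓ) := by
  set N := (n - ℓ).choose (r - ℓ) with hNdef
  have hx0 := hx.1
  have hstar := card_starColorings_le hℓ (by omega) hφ hE univ
  have hmax : ∏ t ∈ univ.image φ, #{σ | φ σ = t} ≤ maxProd k := by
    simpa using prod_card_fiber_le (univ : Finset (Fin k)) φ
  rcases (starColorings φ E univ).eq_empty_or_nonempty with hempty | hne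
  · rw [hempty, card_empty, Nat.cast_zero]
    positivity
  refine (Nat.cast_le.2 hstar).trans ?_
  rw [Nat.cast_mul, Nat.cast_pow]
  refine mul_le_mul_of_nonneg_left ?_ (by positivity)
  by_cases hopt : ∏ t ∈ univ.image φ, #{σ | φ σ = t} = maxProd k
  · obtain ⟨σ₀, hσ₀⟩ : ∃ σ₀, 2 * degree E (φ σ₀) < N := by
      by_contra! hcon
      exact hnot (mem_optimalMaps_of_heavy hℓ hN hφ hE hne hopt hcon)
    have hmem : φ σ₀ ∈ univ.image φ := mem_image_of_mem _ (mem_univ _)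
    have h2 : 2 ≤ #{σ | φ σ = φ σ₀} :=
      two_le_of_mem_optimalMaps hk (T := univ.image φ) ⟨rfl, hopt⟩ hmem
    rw [← hopt]
    refine hx.prod_pow_le hmem h2 hσ₀ (fun t ht => ?_) fun t ht => ?_
    · obtain ⟨σ, -, rfl⟩ := mem_image.1 ht
      exact card_pos.2 ⟨σ, mem_filter.2 ⟨mem_univ _, rfl⟩⟩
    · obtain ⟨σ, -, rfl⟩ := mem_image.1 ht
      exact degree_le hℓ hE (hφ σ)
  · refine (Nat.cast_le.2 (prod_fiber_pow_degree_le hℓ hφ hE univ)).trans ?_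
    exact hx.pow_le_of_lt (lt_of_le_of_ne hmax hopt) N

/-- The sum over all balanced maps of the number of ways to choose an available color for every
`r`-set, the centers being the sets `u i`. -/
def totalChoices (k r : ℕ) {J : Type*} [Fintype J] [DecidableEq J] (u : J → Finset (Fin n)) : ℕ :=
  ∑ α ∈ balancedMaps k J, choices r (fun i => #{σ | α σ = i}) u

/-- The `max 1` in `choices` makes every factor at least one, so the product over `E` may be
extended to all r-sets. -/
theorem card_starColorings_le_choices {r : ℕ} {J : Type*} [Fintype J] [DecidableEq J]
    (α : Fin k → J) (t : J → Finset (Fin n)) {E : Finset (Finset (Fin n))}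
    (hE : E ⊆ powersetCard r univ) :
    #(starColorings (t ∘ α) E univ) ≤ choices r (fun i => #{σ | α σ = i}) t := by
  rw [card_starColorings, choices]
  calc _ ≤ ∏ e ∈ E, max 1 (weight (fun i => #{σ | α σ = i}) t e) :=
        prod_le_prod' fun e _ => (weight_comp α t e).le.trans (le_max_right _ _)
    _ ≤ _ := prod_le_prod_of_subset_of_one_le' hE fun _ _ _ => le_max_left _ _

/-- All maps in `G` share the image `T`, so `exists_factorization` sends them injectively to
balanced maps. The resulting centers `t` may repeat when a fiber is split, and the shift replaces
them by the disjoint family `u`. -/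
theorem sum_card_starColorings_le {r ℓ : ℕ} (hk : 2 ≤ k) {J : Type*} [Fintype J]
    [DecidableEq J] (hJ : Fintype.card J = (k + 2) / 3) (hn : Fintype.card J * ℓ ≤ n)
    {u : J → Finset (Fin n)} (hu : ∀ i, #(u i) = ℓ) (hd : Pairwise (Function.onFun Disjoint u))
    {E : Finset (Finset (Fin n))} (hE : E ⊆ powersetCard r univ) (T : Finset (Finset (Fin n)))
    (G : Finset (Fin k → Finset (Fin n))) (hG : ∀ φ ∈ G, φ ∈ optimalMaps k T ∧ ∀ σ, #(φ σ) = ℓ) :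
    ∑ φ ∈ G, #(starColorings φ E univ) ≤ totalChoices k r u := by
  obtain ⟨Ψ, hinj, hΨ⟩ := exists_factorization hk hJ T
  calc _ ≤ ∑ φ ∈ G, choices r (fun i => #{σ | Ψ φ σ = i}) u := by
        refine sum_le_sum fun φ hφ => ?_
        obtain ⟨hA, t, ht⟩ := hΨ φ (hG φ hφ).1
        have hcard : ∀ i, #(t i) = ℓ := by
          intro i
          obtain ⟨σ, rfl⟩ := surjective_of_mem_balancedMaps hA i
          rw [← (hG φ hφ).2 σ]
          exact congrArg card (congrFun ht σ).symm
        conv_lhs => rw [ht]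
        exact (card_starColorings_le_choices _ t hE).trans
          (choices_le_of_disjoint r ℓ (mem_filter.1 hA).2.1 hn hcard hu hd)
    _ = ∑ α ∈ G.image Ψ, choices r (fun i => #{σ | α σ = i}) u :=
        (sum_image (f := fun α : Fin k → J => choices r (fun i => #{σ | α σ = i}) u)
          fun φ hφ φ' hφ' h => hinj (hG φ hφ).1 (hG φ' hφ').1 h).symm
    _ ≤ _ := by
        refine sum_le_sum_of_subset fun α hα => ?_
        obtain ⟨φ, hφ, rfl⟩ := mem_image.1 hα
        exact (hΨ φ (hG φ hφ).1).1

/-- Star colorings whose centers form an optimal map onto the heavy sets give the main term. The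
other star colorings and the non-star colorings go into the error. -/
theorem card_colorings_le_totalChoices_add {r ℓ : ℕ} (hℓ : ℓ < r) (hk : 2 ≤ k) (hrn : r ≤ n)
    (hN : 2 * (k * n ^ (r - ℓ - 1)) < (n - ℓ).choose (r - ℓ)) {x : ℝ} (hx : IsRate k x)
    {J : Type*} [Fintype J]
    [DecidableEq J] (hJ : Fintype.card J = (k + 2) / 3) (hn : Fintype.card J * ℓ ≤ n)
    {u : J → Finset (Fin n)} (hu : ∀ i, #(u i) = ℓ) (hd : Pairwise (Function.onFun Disjoint u))
    {E : Finset (Finset (Fin n))} (hE : E ⊆ powersetCard r univ) :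
    (#(colorings ℓ E (univ : Finset (Fin k))) : ℝ) ≤ totalChoices k r u +
      (n + k + 1) ^ (errorExponent r ℓ k * (k + 1) * n ^ (r - ℓ - 1)) *
        (x * maxProd k) ^ (n - ℓ).choose (r - ℓ) := by
  classical
  have hx0 := hx.1
  set P := n ^ (r - ℓ - 1) with hP
  set N := (n - ℓ).choose (r - ℓ) with hNdef
  set K := errorExponent r ℓ k with hK
  have hP1 : 1 ≤ P := Nat.one_le_pow _ _ (by omega)
  obtain ⟨B, hB⟩ : ∃ B, B = n + k + 1 := ⟨_, rfl⟩
  have hBr : ((n : ℝ) + k + 1) = B := by rw [hB]; push_cast; ring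
  have hB1 : (1 : ℝ) ≤ B := by rw [← hBr]; linarith [n.cast_nonneg (α := ℝ), k.cast_nonneg (α := ℝ)]
  have hB2 : (2 : ℝ) ≤ B := by
    rw [← hBr]
    have : (2 : ℝ) ≤ k := by exact_mod_cast hk
    linarith [n.cast_nonneg (α := ℝ)]
  rw [hBr]
  set Y : ℝ := (x * maxProd k) ^ N with hY
  have hY0 : 0 ≤ Y := by positivity
  set C := Fintype.piFinset fun _ : Fin k => powersetCard ℓ (univ : Finset (Fin n)) with hC
  have hCφ : ∀ φ ∈ C, ∀ σ, #(φ σ) = ℓ := fun φ hφ σ =>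
    (mem_powersetCard.1 (Fintype.mem_piFinset.1 hφ σ)).2
  have hgood : (∑ φ ∈ C with φ ∈ optimalMaps k (heavySets r ℓ E),
      (#(starColorings φ E univ) : ℝ)) ≤ totalChoices k r u := by
    rw [← Nat.cast_sum, Nat.cast_le]
    exact sum_card_starColorings_le hk hJ hn hu hd hE (heavySets r ℓ E) _ fun φ hφ =>
      ⟨(mem_filter.1 hφ).2, hCφ φ (mem_filter.1 hφ).1⟩
  have hbad : (∑ φ ∈ C with φ ∉ optimalMaps k (heavySets r ℓ E),
      (#(starColorings φ E univ) : ℝ)) ≤ (B : ℝ) ^ (K * (k + 1) * P - 1) * Y := by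
    refine (sum_le_card_nsmul _ _ ((k : ℝ) ^ (k * k * P) * Y) fun φ hφ =>
      card_starColorings_le_of_notMem hℓ hk hN hx (hCφ φ (mem_filter.1 hφ).1) hE
        (mem_filter.1 hφ).2).trans ?_
    rw [nsmul_eq_mul, ← mul_assoc]
    refine mul_le_mul_of_nonneg_right ?_ hY0
    have h1 : #{φ ∈ C | φ ∉ optimalMaps k (heavySets r ℓ E)} ≤ B ^ (ℓ * k) :=
      (card_filter_le _ _).trans ((card_centers_le n k).trans (Nat.pow_le_pow_left (by omega) _))
    have h2 : k ^ (k * k * P) ≤ B ^ (k * k * P) := Nat.pow_le_pow_left (by omega) _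
    have h3 : B ^ (ℓ * k) * B ^ (k * k * P) ≤ B ^ (K * (k + 1) * P - 1) := by
      rw [← pow_add]
      refine Nat.pow_le_pow_right (by omega) (Nat.le_sub_one_of_lt ?_)
      have h1 : ℓ * k ≤ ℓ * k * P := Nat.le_mul_of_pos_right _ hP1
      have h2 : (ℓ * k + k * k + 2) * P ≤ K * (k + 1) * P := by
        refine Nat.mul_le_mul_right _ ?_
        refine le_trans ?_ (Nat.le_mul_of_pos_right K (by omega))
        rw [hK, errorExponent]
        omega
      nlinarith
    exact_mod_cast (Nat.mul_le_mul h1 h2).trans h3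
  have hnon : (#(nonStarColorings ℓ E (univ : Finset (Fin k))) : ℝ) ≤
      (B : ℝ) ^ (K * (k + 1) * P - 1) * Y := by
    have hlt : maxProd (k - 1) < maxProd k := by
      have := maxProd_lt_succ (m := k - 1) (by omega)
      rwa [Nat.sub_add_cancel (by omega)] at this
    have h1 := card_nonStarColorings_le hℓ hE (univ : Finset (Fin k))
      (B ^ (K * k * P) * maxProd (k - 1) ^ N) fun E' hE' σ hσ => by
        have := card_colorings_le hℓ (by omega : 1 ≤ k) hrn (univ.erase σ) hE'
        rw [card_erase_of_mem hσ, card_univ, Fintype.card_fin, Nat.sub_add_cancel (by omega),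
          ← hB] at this
        exact this
    have h2 : k * (n + 1) ^ (r * (2 ^ r * r * P)) * B ^ (K * k * P) ≤
        B ^ (K * (k + 1) * P - 1) := by
      calc _ ≤ B ^ 1 * B ^ (r * (2 ^ r * r * P)) * B ^ (K * k * P) := by
            refine Nat.mul_le_mul_right _ (Nat.mul_le_mul (by rw [pow_one]; omega) ?_)
            exact Nat.pow_le_pow_left (by omega) _
        _ = B ^ (1 + r * (2 ^ r * r * P) + K * k * P) := by rw [← pow_add, ← pow_add]
        _ ≤ _ := by
          refine Nat.pow_le_pow_right (by omega) (Nat.le_sub_one_of_lt ?_)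
          have h2 : (r * (2 ^ r * r) + 2) * P ≤ K * P := by
            refine Nat.mul_le_mul_right _ ?_
            rw [hK, errorExponent]
            omega
          have h3 : K * (k + 1) * P = K * k * P + K * P := by ring
          rw [h3]
          nlinarith
    rw [← mul_assoc, ← mul_assoc] at h1
    refine (Nat.cast_le.2 h1).trans ?_
    rw [Nat.cast_mul]
    refine mul_le_mul ?_ (hx.pow_le_of_lt hlt N) (Nat.cast_nonneg _) (by positivity)
    exact_mod_cast h2
  have hKpos : 1 ≤ K * (k + 1) * P := Nat.mul_pos (Nat.mul_pos (by
    rw [hK, errorExponent]; omega) (by omega)) hP1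
  have htotal : (#(colorings ℓ E (univ : Finset (Fin k))) : ℝ) ≤
      (∑ φ ∈ C, (#(starColorings φ E univ) : ℝ)) +
        #(nonStarColorings ℓ E (univ : Finset (Fin k))) := by
    have h1 := (card_le_card (colorings_subset (by omega : ℓ ≤ n) E (univ : Finset (Fin k)))).trans
      (card_union_le _ _)
    have h2 := h1.trans (Nat.add_le_add_right card_biUnion_le _)
    exact_mod_cast h2
  rw [← sum_filter_add_sum_filter_not C (fun φ => φ ∈ optimalMaps k (heavySets r ℓ E))] at htotal
  have hpow : (B : ℝ) ^ (K * (k + 1) * P) = B * (B : ℝ) ^ (K * (k + 1) * P - 1) := by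
    rw [← pow_succ', Nat.sub_add_cancel hKpos]
  have hfin : 2 * ((B : ℝ) ^ (K * (k + 1) * P - 1) * Y) ≤ (B : ℝ) ^ (K * (k + 1) * P) * Y := by
    rw [hpow, mul_assoc (B : ℝ)]
    exact mul_le_mul_of_nonneg_right hB2 (by positivity)
  linarith

end UpperBound

/-! ### The lower bound for disjoint centers -/

section LowerBound

variable {n k : ℕ}

theorem injective_of_pairwise_disjoint {J : Type*} {ℓ : ℕ} (hℓ : 1 ≤ ℓ) {u : J → Finset (Fin n)}
    (hu : ∀ i, #(u i) = ℓ) (hd : Pairwise (Function.onFun Disjoint u)) :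
    Function.Injective u := by
  intro i j hij
  by_contra hne
  have h := hd hne
  rw [Function.onFun, ← hij, disjoint_self] at h
  have := hu i
  rw [h] at this
  simp at this
  omega

theorem choices_pos {J : Type*} [Fintype J] (r : ℕ) (a : J → ℕ) (u : J → Finset (Fin n)) : 0 < choices r a u :=
  prod_pos fun _ _ => by positivity

section Covered

variable {J : Type*} [Fintype J]

/-- The `r`-sets that contain some member of the family `u`. -/
def coveredSets (r : ℕ) (u : J → Finset (Fin n)) : Finset (Finset (Fin n)) :=
  {e ∈ powersetCard r univ | ∃ i, u i ⊆ e}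

theorem starColorings_subset_colorings {ℓ : ℕ} {φ : Fin k → Finset (Fin n)}
    (hφ : ∀ σ, #(φ σ) = ℓ) (E : Finset (Finset (Fin n))) :
    starColorings φ E univ ⊆ colorings ℓ E univ := by
  intro Δ hΔ
  obtain ⟨h1, h2⟩ := mem_starColorings.1 hΔ
  refine mem_colorings.2 ⟨fun e he => ?_, h2, fun e he f hf _ hc => ?_⟩
  · obtain ⟨σ, hσ, -, h⟩ := h1 e he
    exact ⟨σ, hσ, h⟩
  · obtain ⟨σ, -, hσ, h⟩ := h1 e he
    obtain ⟨τ, -, hτ, h'⟩ := h1 f hf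
    have hστ : σ = τ := by
      rw [h, h'] at hc
      exact Option.some_injective _ hc
    subst hστ
    rw [← hφ σ]
    exact card_le_card (subset_inter hσ hτ)

variable [DecidableEq J]

theorem card_starColorings_coveredSets (r : ℕ) {α : Fin k → J} (hα : Function.Surjective α)
    (u : J → Finset (Fin n)) :
    #(starColorings (u ∘ α) (coveredSets r u) univ) =
      choices r (fun i => #{σ | α σ = i}) u := by
  rw [card_starColorings, choices,
    ← prod_subset (filter_subset (fun e => ∃ i, u i ⊆ e) (powersetCard r univ))]
  · refine prod_congr rfl fun e he => ?_
    rw [weight_comp]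
    obtain ⟨i, hi⟩ := (mem_filter.1 he).2
    obtain ⟨σ, rfl⟩ := hα i
    refine (max_eq_right ?_).symm
    rw [← weight_comp]
    exact card_pos.2 ⟨σ, mem_filter.2 ⟨mem_univ _, hi⟩⟩
  · intro e he hne
    rw [weight, filter_eq_empty_iff.2, sum_empty, max_eq_left zero_le_one]
    intro i _ hi
    exact hne (mem_filter.2 ⟨he, i, hi⟩)

/-- Colorings compatible with two distinct balanced maps are rare. -/
theorem card_starColorings_inter_le {r ℓ : ℕ} (hℓ1 : 1 ≤ ℓ) (hℓ : ℓ < r) (hk : 2 ≤ k)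
    (hJ : Fintype.card J ≤ k) {x : ℝ} (hx : IsRate k x) {u : J → Finset (Fin n)}
    (hu : ∀ i, #(u i) = ℓ) (hd : Pairwise (Function.onFun Disjoint u))
    {E : Finset (Finset (Fin n))} (hE : E ⊆ powersetCard r univ) {α β : Fin k → J}
    (hα : α ∈ balancedMaps k J) (hne : α ≠ β) :
    (#(starColorings (u ∘ α) E univ ∩ starColorings (u ∘ β) E univ) : ℝ) ≤
      (k : ℝ) ^ (k * k * n ^ (r - ℓ - 1)) * (x * maxProd k) ^ (n - ℓ).choose (r - ℓ) := by
  have hinj := injective_of_pairwise_disjoint hℓ1 hu hd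
  obtain ⟨h2, hprod⟩ := (mem_filter.1 hα).2
  have hsub : starColorings (u ∘ α) E univ ∩ starColorings (u ∘ β) E univ ⊆
      starColorings (fun σ => u (α σ) ∪ u (β σ)) E univ := by
    intro Δ hΔ
    obtain ⟨h1, h2⟩ := mem_inter.1 hΔ
    obtain ⟨h1, h1'⟩ := mem_starColorings.1 h1
    obtain ⟨h2, -⟩ := mem_starColorings.1 h2
    refine mem_starColorings.2 ⟨fun e he => ?_, h1'⟩
    obtain ⟨σ, hσ, hs, hc⟩ := h1 e he
    obtain ⟨τ, -, ht, hc'⟩ := h2 e he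
    have hστ : σ = τ := Option.some_injective _ (hc.symm.trans hc')
    subst hστ
    exact ⟨σ, hσ, union_subset hs ht, hc⟩
  have hT : ∀ t ∈ univ.image u, #t = ℓ := by
    intro t ht
    obtain ⟨i, -, rfl⟩ := mem_image.1 ht
    exact hu i
  -- A color used on `e` must have both its centers inside `e`. When `e` contains a single member
  -- `t` of the family, both centers equal `t`. The `max 1` allows for the case that no color has
  -- this property.
  have hle := prod_weight_le hℓ (by omega : 1 ≤ k) hE hT (card_image_le.trans hJ)
    (fun e => #{σ : Fin k | u (α σ) ∪ u (β σ) ⊆ e})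
    (fun t => max 1 #{σ : Fin k | u (α σ) = t ∧ u (β σ) = t})
    (fun e _ => by simpa using card_le_univ {σ : Fin k | u (α σ) ∪ u (β σ) ⊆ e})
    (fun t _ => le_max_left _ _) (fun e _ h => by
      obtain ⟨σ, hσ⟩ := card_pos.1 (Nat.pos_of_ne_zero h)
      exact ⟨u (α σ), mem_image_of_mem _ (mem_univ _),
        subset_union_left.trans (mem_filter.1 hσ).2⟩)
    (fun e _ t _ _ huniq => (card_le_card fun σ hσ => by
      have hσ := (mem_filter.1 hσ).2
      exact mem_filter.2 ⟨mem_univ _,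
        huniq _ (mem_image_of_mem _ (mem_univ _)) (subset_union_left.trans hσ),
        huniq _ (mem_image_of_mem _ (mem_univ _)) (subset_union_right.trans hσ)⟩).trans
      (le_max_right _ _))
  -- At a color `σ₀` where the maps differ, the fiber of `α` over `α σ₀` loses `σ₀`. Since fibers of
  -- `α` have size at least two, the strict drop survives the `max 1`.
  have hlt : ∏ t ∈ univ.image u, max 1 #{σ : Fin k | u (α σ) = t ∧ u (β σ) = t} < maxProd k := by
    rw [prod_image fun i _ j _ h => hinj h, ← hprod]
    obtain ⟨σ₀, hσ₀⟩ := Function.ne_iff.1 hne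
    have hsubset : ∀ i, ({σ | u (α σ) = u i ∧ u (β σ) = u i} : Finset (Fin k)) ⊆
        ({σ | α σ = i} : Finset (Fin k)) := fun i σ hσ =>
      mem_filter.2 ⟨mem_univ _, hinj (mem_filter.1 hσ).2.1⟩
    refine prod_lt_prod (fun i _ => by positivity) (fun i _ => ?_) ⟨α σ₀, mem_univ _, ?_⟩
    · exact max_le (by have := h2 i; omega) (card_le_card (hsubset i))
    · refine max_lt (h2 _) (card_lt_card (Finset.ssubset_iff_subset_ne.2 ⟨hsubset _, fun h => ?_⟩))
      have hmem : σ₀ ∈ ({σ | α σ = α σ₀} : Finset (Fin k)) := mem_filter.2 ⟨mem_univ _, rfl⟩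
      rw [← h] at hmem
      exact hσ₀ (hinj (mem_filter.1 hmem).2.2).symm
  have hpow : ∏ t ∈ univ.image u,
      (max 1 #{σ : Fin k | u (α σ) = t ∧ u (β σ) = t}) ^ degree E t ≤
      (∏ t ∈ univ.image u, max 1 #{σ : Fin k | u (α σ) = t ∧ u (β σ) = t}) ^
        (n - ℓ).choose (r - ℓ) := by
    rw [← prod_pow]
    exact prod_le_prod' fun t ht =>
      Nat.pow_le_pow_right (by positivity) (degree_le hℓ hE (hT t ht))
  have hnat := (card_le_card hsub).trans (((card_starColorings _ _ _).trans_le hle).trans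
    (Nat.mul_le_mul_left _ hpow))
  refine (Nat.cast_le.2 hnat).trans ?_
  rw [Nat.cast_mul, Nat.cast_pow]
  exact mul_le_mul_of_nonneg_left (hx.pow_le_of_lt hlt _) (by positivity)

/-- A Bonferroni inequality. -/
theorem sum_card_le_card_biUnion_add {ι X : Type*} [DecidableEq ι] [DecidableEq X] (A : Finset ι)
    (S : ι → Finset X) {D : ℝ} (hD0 : 0 ≤ D)
    (hD : ∀ i ∈ A, ∀ j ∈ A, i ≠ j → (#(S i ∩ S j) : ℝ) ≤ D) :
    ∑ i ∈ A, (#(S i) : ℝ) ≤ #(A.biUnion S) + (#A : ℝ) * #A * D := by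
  induction A using Finset.induction_on with
  | empty => simp
  | insert a A ha ih =>
    have ih' := ih fun i hi j hj => hD i (mem_insert_of_mem hi) j (mem_insert_of_mem hj)
    have h1 : (#(S a ∩ A.biUnion S) : ℝ) ≤ #A * D := by
      rw [inter_biUnion]
      refine (Nat.cast_le.2 card_biUnion_le).trans ?_
      rw [Nat.cast_sum, ← nsmul_eq_mul]
      refine sum_le_card_nsmul _ _ _ fun j hj => hD a (mem_insert_self _ _) j
        (mem_insert_of_mem hj) ?_
      rintro rfl
      exact ha hj
    have h2 : (#(S a ∪ A.biUnion S) : ℝ) + #(S a ∩ A.biUnion S) = #(S a) + #(A.biUnion S) := by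
      exact_mod_cast card_union_add_card_inter (S a) (A.biUnion S)
    rw [sum_insert ha, biUnion_insert, card_insert_of_notMem ha]
    push_cast
    have : 0 ≤ (#A : ℝ) * D := by positivity
    nlinarith

/-- The star colorings for the various balanced maps all lie in one set of colorings and overlap
rarely, so Bonferroni applies. The factor k^(2k) bounds the number of pairs of balanced maps. -/
theorem totalChoices_le {r ℓ : ℕ} (hℓ1 : 1 ≤ ℓ) (hℓ : ℓ < r) (hk : 2 ≤ k)
    (hJ : Fintype.card J ≤ k) {x : ℝ} (hx : IsRate k x) {u : J → Finset (Fin n)}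
    (hu : ∀ i, #(u i) = ℓ) (hd : Pairwise (Function.onFun Disjoint u)) :
    (totalChoices k r u : ℝ) ≤ #(colorings ℓ (coveredSets r u) (univ : Finset (Fin k))) +
      (k : ℝ) ^ (2 * k + k * k * n ^ (r - ℓ - 1)) *
        (x * maxProd k) ^ (n - ℓ).choose (r - ℓ) := by
  have hx0 := hx.1
  have hbon := sum_card_le_card_biUnion_add (balancedMaps k J)
    (fun α => starColorings (u ∘ α) (coveredSets r u) univ)
    (D := (k : ℝ) ^ (k * k * n ^ (r - ℓ - 1)) * (x * maxProd k) ^ (n - ℓ).choose (r - ℓ))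
    (by positivity) fun α hα β _ hne =>
      card_starColorings_inter_le hℓ1 hℓ hk hJ hx hu hd (filter_subset _ _) hα hne
  have hcardA : (#(balancedMaps k J) : ℝ) ≤ (k : ℝ) ^ k := by
    have : #(balancedMaps k J) ≤ k ^ k := by
      refine (card_le_univ _).trans ?_
      rw [Fintype.card_fun, Fintype.card_fin]
      exact Nat.pow_le_pow_left hJ _
    exact_mod_cast this
  have hunion : (#((balancedMaps k J).biUnion fun α =>
      starColorings (u ∘ α) (coveredSets r u) univ) : ℝ) ≤
      #(colorings ℓ (coveredSets r u) (univ : Finset (Fin k))) := by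
    refine Nat.cast_le.2 (card_le_card (biUnion_subset.2 fun α _ => ?_))
    exact starColorings_subset_colorings (fun σ => hu (α σ)) _
  have hsum : (totalChoices k r u : ℝ) = ∑ α ∈ balancedMaps k J,
      (#(starColorings (u ∘ α) (coveredSets r u) univ) : ℝ) := by
    rw [totalChoices, Nat.cast_sum]
    refine sum_congr rfl fun α hα => ?_
    rw [card_starColorings_coveredSets r (surjective_of_mem_balancedMaps hα)]
  rw [hsum]
  refine hbon.trans (add_le_add hunion ?_)
  rw [pow_add, two_mul, pow_add, mul_assoc ((k : ℝ) ^ k * (k : ℝ) ^ k)]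
  refine mul_le_mul_of_nonneg_right ?_ (by positivity)
  exact mul_le_mul hcardA hcardA (by positivity) (by positivity)

/-- The number of choices is at least the main term, up to lower order terms in the exponent. -/
theorem maxProd_pow_le {r ℓ : ℕ} (hℓ1 : 1 ≤ ℓ) (hℓ : ℓ < r)
    (hJ : Fintype.card J ≤ k) {u : J → Finset (Fin n)}
    (hu : ∀ i, #(u i) = ℓ) (hd : Pairwise (Function.onFun Disjoint u)) {α : Fin k → J}
    (hα : α ∈ balancedMaps k J) :
    maxProd k ^ (n - ℓ).choose (r - ℓ) ≤
      k ^ (k * (k * k * n ^ (r - ℓ - 1))) * choices r (fun i => #{σ | α σ = i}) u := by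
  have hinj := injective_of_pairwise_disjoint hℓ1 hu hd
  obtain ⟨h2, hprod⟩ := (mem_filter.1 hα).2
  rcases Nat.eq_zero_or_pos k with rfl | hk
  · have : IsEmpty J := Fintype.card_eq_zero_iff.1 (by omega)
    have h1 : maxProd 0 = 1 := by rw [← hprod]; simp
    rw [h1, one_pow]
    simp [choices, weight]
  have hT : ∀ t ∈ univ.image u, #t = ℓ := by
    intro t ht
    obtain ⟨i, -, rfl⟩ := mem_image.1 ht
    exact hu i
  have hmain : maxProd k ^ (n - ℓ).choose (r - ℓ) =
      ∏ e ∈ powersetCard r univ, ∏ i, if u i ⊆ e then #{σ | α σ = i} else 1 := by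
    rw [prod_comm, ← hprod, ← prod_pow]
    refine prod_congr rfl fun i _ => ?_
    rw [prod_ite, prod_const, prod_const_one, mul_one, ← degree_powersetCard hℓ (hu i), degree]
  -- The product and the sum of the fiber sizes agree for a set containing just one member of the
  -- family. The doubly covered sets cost at most k^k each.
  have hpoint : ∀ e ∈ powersetCard r univ, (∏ i, if u i ⊆ e then #{σ | α σ = i} else 1) ≤
      (if e ∈ doublyCovered (powersetCard r univ) (univ.image u) then k ^ k else 1) *
        max 1 (weight (fun i => #{σ | α σ = i}) u e) := by
    intro e he
    split_ifs with hd
    · refine le_trans ?_ (Nat.le_mul_of_pos_right _ (by positivity))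
      calc _ ≤ ∏ _i : J, k := prod_le_prod' fun i _ => by
            split_ifs
            · simpa using card_le_univ {σ | α σ = i}
            · exact hk
        _ = k ^ Fintype.card J := by rw [prod_const, card_univ]
        _ ≤ _ := Nat.pow_le_pow_right hk hJ
    · rw [one_mul]
      by_cases hex : ∃ i, u i ⊆ e
      · obtain ⟨i, hi⟩ := hex
        have huniq : ∀ j, u j ⊆ e → j = i := by
          intro j hj
          by_contra hne
          exact hd (mem_filter.2 ⟨he, u j, mem_image_of_mem _ (mem_univ _), u i,
            mem_image_of_mem _ (mem_univ _), fun h => hne (hinj h), hj, hi⟩)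
        rw [prod_eq_single_of_mem i (mem_univ _) fun j _ hne => if_neg fun h => hne (huniq j h),
          if_pos hi]
        refine le_trans ?_ (le_max_right _ _)
        exact single_le_sum (f := fun i => #{σ | α σ = i}) (fun _ _ => Nat.zero_le _)
          (mem_filter.2 ⟨mem_univ i, hi⟩)
      · push Not at hex
        rw [prod_eq_one fun i _ => if_neg (hex i)]
        exact le_max_left _ _
  rw [hmain]
  refine (prod_le_prod' hpoint).trans ?_
  rw [prod_mul_distrib]
  refine Nat.mul_le_mul_right _ ?_
  rw [prod_ite, prod_const, prod_const_one, mul_one, ← pow_mul]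
  refine Nat.pow_le_pow_right hk (Nat.mul_le_mul_left _ ?_)
  calc _ ≤ #(doublyCovered (powersetCard r univ) (univ.image u)) :=
        card_le_card fun e he => (mem_filter.1 he).2
    _ ≤ _ := card_doublyCovered_le hℓ Subset.rfl hT
    _ ≤ _ := Nat.mul_le_mul_right _
        (Nat.mul_le_mul (card_image_le.trans hJ) (card_image_le.trans hJ))

theorem choices_le_card_colorings {r ℓ : ℕ} {u : J → Finset (Fin n)} (hu : ∀ i, #(u i) = ℓ)
    {α : Fin k → J} (hα : α ∈ balancedMaps k J) :
    choices r (fun i => #{σ | α σ = i}) u ≤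
      #(colorings ℓ (coveredSets r u) (univ : Finset (Fin k))) := by
  rw [← card_starColorings_coveredSets r (surjective_of_mem_balancedMaps hα)]
  exact card_le_card (starColorings_subset_colorings (fun σ => hu (α σ)) _)

end Covered

/-! ### Translation between `kappa` and partial colorings of finite sets -/

section Kappa

theorem card_colorings_le_of_perm {ℓ : ℕ} (π : Equiv.Perm (Fin n))
    {E E' : Finset (Finset (Fin n))} (h : ∀ e, e.map π.toEmbedding ∈ E' ↔ e ∈ E)
    (M : Finset (Fin k)) : #(colorings ℓ E' M) ≤ #(colorings ℓ E M) := by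
  have hmap : ∀ e : Finset (Fin n), (e.map π.symm.toEmbedding).map π.toEmbedding = e := by
    intro e
    ext x; simp
  refine card_le_card_of_injOn (fun Δ e => Δ (e.map π.toEmbedding)) ?_ ?_
  · intro Δ hΔ
    obtain ⟨h1, h2, h3⟩ := mem_colorings.1 hΔ
    refine mem_colorings.2 ⟨fun e he => h1 _ ((h e).2 he),
      fun e he => h2 _ fun h' => he ((h e).1 h'), fun e he f hf hne hc => ?_⟩
    have := h3 _ ((h e).2 he) _ ((h f).2 hf) (fun h' => hne (map_injective _ h')) hc
    rwa [← map_inter, card_map] at this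
  · intro Δ _ Δ' _ heq
    funext e
    have := congrFun heq (e.map π.symm.toEmbedding)
    simp only [hmap] at this
    exact this

theorem card_colorings_coveredSets_le {r ℓ : ℕ} {J : Type*} [Fintype J] [DecidableEq J]
    {u v : J → Finset (Fin n)} (hu : ∀ i, #(u i) = ℓ)
    (hv : ∀ i, #(v i) = ℓ) (hdu : Pairwise (Function.onFun Disjoint u))
    (hdv : Pairwise (Function.onFun Disjoint v)) (M : Finset (Fin k)) :
    #(colorings ℓ (coveredSets r v) M) ≤ #(colorings ℓ (coveredSets r u) M) := by
  obtain ⟨π, hπ⟩ := exists_perm_image_eq hu hv hdu hdv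
  refine card_colorings_le_of_perm π (fun e => ?_) M
  simp only [coveredSets, mem_filter, mem_powersetCard, subset_univ, true_and, card_map, ← hπ,
    map_subset_map]

open Classical in
/-- The hyperedges of `H` as finite sets. -/
noncomputable def edgeFinset (H : Hypergraph (Fin n)) : Finset (Finset (Fin n)) :=
  {e | (e : Set (Fin n)) ∈ H.edgeSet}

theorem mem_edgeFinset {H : Hypergraph (Fin n)} {e : Finset (Fin n)} :
    e ∈ edgeFinset H ↔ (e : Set (Fin n)) ∈ H.edgeSet := by
  simp [edgeFinset]

theorem edgeFinset_subset {H : Hypergraph (Fin n)} {r : ℕ} (hH : IsUniform H r) :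
    edgeFinset H ⊆ powersetCard r univ := by
  intro e he
  have := hH _ (mem_edgeFinset.1 he)
  rw [Set.encard_coe_eq_coe_finsetCard] at this
  exact mem_powersetCard.2 ⟨subset_univ _, by exact_mod_cast this⟩

theorem kappa_eq (H : Hypergraph (Fin n)) (k ℓ : ℕ) :
    kappa H k ℓ = #(colorings ℓ (edgeFinset H) (univ : Finset (Fin k))) := by
  classical
  have hinter : ∀ e f : Finset (Fin n),
      (ℓ : ℕ∞) ≤ ((e : Set (Fin n)) ∩ (f : Set (Fin n))).encard ↔ ℓ ≤ #(e ∩ f) := by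
    intro e f
    rw [← coe_inter, Set.encard_coe_eq_coe_finsetCard, Nat.cast_le]
  have hcoe : ∀ e : Set (Fin n), ∃ e' : Finset (Fin n), (e' : Set (Fin n)) = e :=
    fun e => ⟨e.toFinset, Set.coe_toFinset e⟩
  let F : (H.edgeSet → Fin k) → Finset (Fin n) → Option (Fin k) := fun Δ e =>
    if he : (e : Set (Fin n)) ∈ H.edgeSet then some (Δ ⟨e, he⟩) else none
  have hF : ∀ Δ, ∀ e : Finset (Fin n), ∀ he : (e : Set (Fin n)) ∈ H.edgeSet,
      F Δ e = some (Δ ⟨e, he⟩) := fun Δ e he => dif_pos he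
  have hmem : ∀ Δ, IsKneserColoring H ℓ Δ → F Δ ∈ colorings ℓ (edgeFinset H) univ := by
    intro Δ hΔ
    refine mem_colorings.2 ⟨fun e he => ⟨_, mem_univ _, hF Δ e (mem_edgeFinset.1 he)⟩,
      fun e he => dif_neg fun h => he (mem_edgeFinset.2 h), fun e he f hf hne hc => ?_⟩
    rw [hF Δ e (mem_edgeFinset.1 he), hF Δ f (mem_edgeFinset.1 hf)] at hc
    refine (hinter e f).1 (hΔ ⟨e, mem_edgeFinset.1 he⟩ ⟨f, mem_edgeFinset.1 hf⟩ ?_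
      (Option.some_injective _ hc))
    intro h
    exact hne (coe_injective (congrArg Subtype.val h))
  rw [kappa, ← Nat.card_eq_finsetCard]
  refine Nat.card_congr (Equiv.ofBijective (fun Δ => ⟨F Δ.1, hmem Δ.1 Δ.2⟩) ⟨?_, ?_⟩)
  · rintro ⟨Δ, _⟩ ⟨Δ', _⟩ h
    refine Subtype.ext (funext fun ⟨e, he⟩ => ?_)
    obtain ⟨e, rfl⟩ := hcoe e
    have := congrFun (congrArg Subtype.val h) e
    simp only [hF _ e he] at this
    exact Option.some_injective _ this
  · rintro ⟨Δ', hΔ'⟩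
    obtain ⟨h1, h2, h3⟩ := mem_colorings.1 hΔ'
    have h1' : ∀ e : H.edgeSet, ∃ σ, Δ' (e : Set (Fin n)).toFinset = some σ := fun e => by
      obtain ⟨σ, -, h⟩ := h1 (e : Set (Fin n)).toFinset
        (mem_edgeFinset.2 (by rw [Set.coe_toFinset]; exact e.2))
      exact ⟨σ, h⟩
    choose Δ hΔ using h1'
    have hFΔ : F Δ = Δ' := by
      funext e
      by_cases he : (e : Set (Fin n)) ∈ H.edgeSet
      · rw [hF Δ e he, ← hΔ ⟨e, he⟩, toFinset_coe]
      · rw [h2 e fun h => he (mem_edgeFinset.1 h)]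
        exact dif_neg he
    refine ⟨⟨Δ, fun e f hne hc => ?_⟩, Subtype.ext hFΔ⟩
    obtain ⟨e, he⟩ := e
    obtain ⟨f, hf⟩ := f
    obtain ⟨e, rfl⟩ := hcoe e
    obtain ⟨f, rfl⟩ := hcoe f
    refine (hinter e f).2 (h3 e (mem_edgeFinset.2 he) f (mem_edgeFinset.2 hf) ?_ ?_)
    · rintro rfl
      exact hne rfl
    · rw [← hFΔ, hF Δ e he, hF Δ f hf, hc]

theorem edgeFinset_completeHypergraph {J : Type*} [Fintype J] (r : ℕ)
    {C : Finset (Finset (Fin n))} {u : J → Finset (Fin n)} (hu : ∀ t, t ∈ C ↔ ∃ i, u i = t) :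
    edgeFinset (completeHypergraph C r) = coveredSets r u := by
  ext e
  rw [mem_edgeFinset, coveredSets, mem_filter, mem_powersetCard]
  simp only [completeHypergraph, Set.mem_ofPred_eq, Set.encard_coe_eq_coe_finsetCard,
    Nat.cast_inj, coe_subset, subset_univ, true_and, hu]
  refine and_congr_right fun _ => ⟨?_, ?_⟩
  · rintro ⟨t, ⟨i, rfl⟩, h⟩
    exact ⟨i, h⟩
  · rintro ⟨i, h⟩
    exact ⟨_, ⟨i, rfl⟩, h⟩

theorem isUniform_completeHypergraph (C : Finset (Finset (Fin n))) (r : ℕ) :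
    IsUniform (completeHypergraph C r) r := fun _ he => he.1

/-- An enumeration of the members of a disjoint cover. -/
theorem IsDisjointCover.exists_enumeration {ℓ : ℕ} {C : Finset (Finset (Fin n))}
    (hC : IsDisjointCover C k ℓ) :
    ∃ u : Fin ((k + 2) / 3) → Finset (Fin n), (∀ t, t ∈ C ↔ ∃ i, u i = t) ∧
      (∀ i, #(u i) = ℓ) ∧ Pairwise (Function.onFun Disjoint u) := by
  let g := C.equivFinOfCardEq (hC.card_eq.trans (ceil_div_three k))
  refine ⟨fun i => g.symm i, fun t => ⟨fun ht => ⟨g ⟨t, ht⟩, by simp⟩, ?_⟩,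
    fun i => hC.card_mem _ (g.symm i).2, fun i j hij => ?_⟩
  · rintro ⟨i, rfl⟩
    exact (g.symm i).2
  · refine hC.disjoint _ (g.symm i).2 _ (g.symm j).2 fun h => hij ?_
    exact g.symm.injective (Subtype.ext h)

/-- The number of colorings of `completeHypergraph C r` does not depend on the disjoint
cover `C`. -/
theorem IsDisjointCover.kappa_eq {r ℓ : ℕ} {C C' : Finset (Finset (Fin n))}
    (hC : IsDisjointCover C k ℓ) (hC' : IsDisjointCover C' k ℓ) :
    kappa (completeHypergraph C r) k ℓ = kappa (completeHypergraph C' r) k ℓ := by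
  obtain ⟨u, h1, h2, h3⟩ := hC.exists_enumeration
  obtain ⟨v, h1', h2', h3'⟩ := hC'.exists_enumeration
  rw [KneserColoring.kappa_eq, KneserColoring.kappa_eq, edgeFinset_completeHypergraph r h1,
    edgeFinset_completeHypergraph r h1']
  exact le_antisymm (card_colorings_coveredSets_le h2' h2 h3' h3 _)
    (card_colorings_coveredSets_le h2 h2' h3 h3' _)

end Kappa

end LowerBound

/-! ### The error term tends to zero -/

section Asymptotics

open Filter

/-- The binomial coefficient `(n - ℓ).choose (r - ℓ)` has order `n ^ (r - ℓ)`. -/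
theorem pow_le_mul_choose {r ℓ n : ℕ} (hℓ : ℓ < r) (hn : 2 * r ≤ n) :
    n * n ^ (r - ℓ - 1) ≤ 2 ^ (r - ℓ) * (r - ℓ).factorial * (n - ℓ).choose (r - ℓ) := by
  have h1 : (n + 1 - r) ^ (r - ℓ) ≤ (r - ℓ).factorial * (n - ℓ).choose (r - ℓ) := by
    rw [← Nat.descFactorial_eq_factorial_mul_choose]
    refine le_trans (Nat.pow_le_pow_left ?_ _) (Nat.pow_sub_le_descFactorial _ _)
    omega
  calc n * n ^ (r - ℓ - 1) = n ^ (r - ℓ) := by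
        rw [← pow_succ', Nat.sub_add_cancel (by omega)]
    _ ≤ (2 * (n + 1 - r)) ^ (r - ℓ) := Nat.pow_le_pow_left (by omega) _
    _ = 2 ^ (r - ℓ) * (n + 1 - r) ^ (r - ℓ) := mul_pow _ _ _
    _ ≤ _ := by rw [mul_assoc]; exact Nat.mul_le_mul_left _ h1

theorem eventually_mul_pow_lt_choose {r ℓ : ℕ} (hℓ : ℓ < r) (k : ℕ) :
    ∀ᶠ n : ℕ in atTop, 2 * (k * n ^ (r - ℓ - 1)) < (n - ℓ).choose (r - ℓ) := by
  set D := 2 ^ (r - ℓ) * (r - ℓ).factorial with hD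
  filter_upwards [eventually_ge_atTop (2 * r), eventually_gt_atTop (2 * k * D)] with n h1 h2
  have h3 := pow_le_mul_choose hℓ h1
  have h4 : 0 < n ^ (r - ℓ - 1) := Nat.pow_pos (by omega)
  have h5 := Nat.mul_lt_mul_of_pos_right h2 h4
  refine Nat.lt_of_mul_lt_mul_left (a := D) ?_
  calc D * (2 * (k * n ^ (r - ℓ - 1))) = 2 * k * D * n ^ (r - ℓ - 1) := by ring
    _ < n * n ^ (r - ℓ - 1) := h5
    _ ≤ _ := h3

/-- With y^D = x and DN ≥ nP, the expression is at most the P-th power of (n + k + 1)^K y^n. That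
base tends to zero, and once it is at most one its P-th power is no larger. -/
theorem tendsto_pow_mul_pow_choose {r ℓ : ℕ} (hℓ : ℓ < r) (k K : ℕ) {x : ℝ} (hx0 : 0 < x)
    (hx1 : x < 1) :
    Tendsto (fun n : ℕ => ((n : ℝ) + k + 1) ^ (K * n ^ (r - ℓ - 1)) *
      x ^ (n - ℓ).choose (r - ℓ)) atTop (nhds 0) := by
  set D := 2 ^ (r - ℓ) * (r - ℓ).factorial with hD
  have hDpos : 0 < D := by positivity
  obtain ⟨y, hy0, hy1, hyx⟩ : ∃ y : ℝ, 0 < y ∧ y < 1 ∧ y ^ D = x := by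
    refine ⟨x ^ ((D : ℝ)⁻¹), Real.rpow_pos_of_pos hx0 _,
      Real.rpow_lt_one hx0.le hx1 (by positivity), Real.rpow_inv_natCast_pow hx0.le hDpos.ne'⟩
  have hlim : Tendsto (fun n : ℕ => ((n : ℝ) + k + 1) ^ K * y ^ n) atTop (nhds 0) := by
    have h1 := tendsto_pow_const_mul_const_pow_of_abs_lt_one K (r := y)
      (by rw [abs_of_pos hy0]; exact hy1)
    have h2 := ((tendsto_add_atTop_iff_nat (k + 1)).2 h1).mul_const ((y ^ (k + 1))⁻¹)
    rw [zero_mul] at h2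
    refine h2.congr fun n => ?_
    push_cast
    rw [pow_add y n (k + 1)]
    field_simp
    ring
  refine squeeze_zero' (Eventually.of_forall fun n => by positivity) ?_ hlim
  filter_upwards [eventually_ge_atTop (2 * r), hlim.eventually (ge_mem_nhds zero_lt_one)]
    with n hn hle
  have hP : n ^ (r - ℓ - 1) ≠ 0 := (Nat.pow_pos (by omega)).ne'
  calc ((n : ℝ) + k + 1) ^ (K * n ^ (r - ℓ - 1)) * x ^ (n - ℓ).choose (r - ℓ)
      ≤ ((n : ℝ) + k + 1) ^ (K * n ^ (r - ℓ - 1)) * y ^ (n * n ^ (r - ℓ - 1)) := by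
        refine mul_le_mul_of_nonneg_left ?_ (by positivity)
        rw [← hyx, ← pow_mul]
        exact pow_le_pow_of_le_one hy0.le hy1.le (pow_le_mul_choose hℓ hn)
    _ = (((n : ℝ) + k + 1) ^ K * y ^ n) ^ n ^ (r - ℓ - 1) := by
        rw [mul_pow, pow_mul, pow_mul]
    _ ≤ _ := pow_le_of_le_one (by positivity) hle hP

end Asymptotics

/-! ### Conclusion -/

theorem kappa_le_KC {n r : ℕ} (C : Finset (Finset (Fin n))) (k ℓ : ℕ) :
    kappa (completeHypergraph C r) k ℓ ≤ KC n r k ℓ :=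
  (isGreatest_KC n r k ℓ).2 ⟨_, rfl, isUniform_completeHypergraph C r, rfl⟩

theorem IsDisjointCover.kappa_pos {n r k ℓ : ℕ} (hk : 2 ≤ k) {C : Finset (Finset (Fin n))}
    (hC : IsDisjointCover C k ℓ) : 0 < kappa (completeHypergraph C r) k ℓ := by
  obtain ⟨u, h1, h2, h3⟩ := hC.exists_enumeration
  obtain ⟨α, hα⟩ := balancedMaps_nonempty hk (J := Fin ((k + 2) / 3)) (by simp)
  rw [KneserColoring.kappa_eq, edgeFinset_completeHypergraph r h1]
  exact (choices_pos r _ u).trans_le (choices_le_card_colorings h2 hα)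

/-- The quantitative form of the main result. -/
theorem KC_le {n r k ℓ : ℕ} (hℓ1 : 1 ≤ ℓ) (hℓ : ℓ < r) (hk : 2 ≤ k) (hrn : r ≤ n)
    (hn : (k + 2) / 3 * ℓ ≤ n)
    (hN : 2 * (k * n ^ (r - ℓ - 1)) < (n - ℓ).choose (r - ℓ)) {x : ℝ} (hx : IsRate k x)
    {C : Finset (Finset (Fin n))} (hC : IsDisjointCover C k ℓ) :
    (KC n r k ℓ : ℝ) ≤ (1 + ((n : ℝ) + k + 1) ^
      ((errorExponent r ℓ k * (k + 1) + (2 * k + k * k) + 1 + k * (k * k)) * n ^ (r - ℓ - 1)) *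
        x ^ (n - ℓ).choose (r - ℓ)) * kappa (completeHypergraph C r) k ℓ := by
  have hx0 := hx.1
  obtain ⟨u, h1, h2, h3⟩ := hC.exists_enumeration
  obtain ⟨α, hα⟩ := balancedMaps_nonempty hk (J := Fin ((k + 2) / 3)) (by simp)
  obtain ⟨H, -, hH, hHKC⟩ := (isGreatest_KC n r k ℓ).1
  have hJk : Fintype.card (Fin ((k + 2) / 3)) ≤ k := by rw [Fintype.card_fin]; omega
  have hupper := card_colorings_le_totalChoices_add hℓ hk hrn hN hx (Fintype.card_fin _)
    (by rwa [Fintype.card_fin]) h2 h3 (edgeFinset_subset hH)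
  have hlower := totalChoices_le hℓ1 hℓ hk hJk hx h2 h3
  have hmain := (maxProd_pow_le hℓ1 hℓ hJk h2 h3 hα).trans
    (Nat.mul_le_mul_left _ (choices_le_card_colorings (r := r) h2 hα))
  rw [← KneserColoring.kappa_eq, hHKC] at hupper
  rw [← edgeFinset_completeHypergraph r h1, ← KneserColoring.kappa_eq] at hlower hmain
  set P := n ^ (r - ℓ - 1) with hP
  set N := (n - ℓ).choose (r - ℓ) with hNdef
  set κ := kappa (completeHypergraph C r) k ℓ with hκ
  set a := errorExponent r ℓ k * (k + 1) with ha
  have hP1 : 1 ≤ P := Nat.one_le_pow _ _ (by omega)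
  set B : ℝ := (n : ℝ) + k + 1 with hB
  have hkB : (k : ℝ) ≤ B := by rw [hB]; linarith [n.cast_nonneg (α := ℝ)]
  have hk2 : (2 : ℝ) ≤ k := by exact_mod_cast hk
  have hB1 : 1 ≤ B := by linarith
  -- This lower bound on `κ` turns the absolute error, a multiple of (x · maxProd(k))^N, into one
  -- relative to `κ`.
  have hmain' : (maxProd k : ℝ) ^ N ≤ B ^ (k * (k * k) * P) * κ := by
    calc (maxProd k : ℝ) ^ N ≤ (k : ℝ) ^ (k * (k * k * P)) * κ := by exact_mod_cast hmain
      _ ≤ B ^ (k * (k * k * P)) * κ := by gcongr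
      _ = _ := by ring_nf
  have hlower' : (totalChoices k r u : ℝ) ≤ κ + B ^ ((2 * k + k * k) * P) * (x * maxProd k) ^ N := by
    refine hlower.trans ?_
    gcongr
    calc (k : ℝ) ^ (2 * k + k * k * P) ≤ B ^ (2 * k + k * k * P) := by gcongr
      _ ≤ _ := pow_le_pow_right₀ hB1 (by nlinarith)
  have hsum : B ^ (a * P) + B ^ ((2 * k + k * k) * P) ≤ B ^ ((a + (2 * k + k * k) + 1) * P) := by
    calc _ ≤ B ^ ((a + (2 * k + k * k)) * P) + B ^ ((a + (2 * k + k * k)) * P) := by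
          refine add_le_add (pow_le_pow_right₀ hB1 ?_) (pow_le_pow_right₀ hB1 ?_) <;>
            exact Nat.mul_le_mul_right _ (by omega)
      _ = 2 * B ^ ((a + (2 * k + k * k)) * P) := (two_mul _).symm
      _ ≤ B * B ^ ((a + (2 * k + k * k)) * P) := by
          refine mul_le_mul_of_nonneg_right (by linarith) (by positivity)
      _ = B ^ ((a + (2 * k + k * k)) * P + 1) := (pow_succ' _ _).symm
      _ ≤ _ := pow_le_pow_right₀ hB1 (by rw [add_mul _ 1 P]; omega)
  calc (KC n r k ℓ : ℝ)
      ≤ κ + (B ^ (a * P) + B ^ ((2 * k + k * k) * P)) * (x * maxProd k) ^ N := by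
        rw [add_mul]; linarith
    _ ≤ κ + B ^ ((a + (2 * k + k * k) + 1) * P) * (x * maxProd k) ^ N := by gcongr
    _ = κ + B ^ ((a + (2 * k + k * k) + 1) * P) * x ^ N * (maxProd k : ℝ) ^ N := by
        rw [mul_pow]; ring
    _ ≤ κ + B ^ ((a + (2 * k + k * k) + 1) * P) * x ^ N * (B ^ (k * (k * k) * P) * κ) := by
        gcongr
    _ = _ := by rw [add_mul _ (k * (k * k)) P, pow_add B _ (k * (k * k) * P)]; ring

end KneserColoring

theorem theorem1p4 (r k ℓ : ℕ) (hr : 2 ≤ r) (hk : 2 ≤ k) (hℓ : 1 ≤ ℓ) (hℓr : ℓ < r) :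
    ∃ o : ℕ → ℝ, Filter.Tendsto o Filter.atTop (nhds 0) ∧
      ∀ (n : ℕ) (C : Finset (Finset (Fin n))), KneserColoring.IsDisjointCover C k ℓ →
        (KneserColoring.KC n r k ℓ : ℝ) =
          (1 + o n) * (KneserColoring.kappa (KneserColoring.completeHypergraph C r) k ℓ : ℝ) := by
  classical
  -- The relative error is forced wherever a disjoint cover exists and does not depend on its
  -- choice. The value 0 at the other `n` is harmless, as covers exist for all large `n`.
  let o : ℕ → ℝ := fun n =>
    if h : ∃ C : Finset (Finset (Fin n)), KneserColoring.IsDisjointCover C k ℓ then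
      (KneserColoring.KC n r k ℓ : ℝ) /
        KneserColoring.kappa (KneserColoring.completeHypergraph h.choose r) k ℓ - 1
    else 0
  have ho : ∀ (n : ℕ) (C : Finset (Finset (Fin n))), KneserColoring.IsDisjointCover C k ℓ →
      o n = (KneserColoring.KC n r k ℓ : ℝ) /
        KneserColoring.kappa (KneserColoring.completeHypergraph C r) k ℓ - 1 := by
    intro n C hC
    have hex : ∃ C : Finset (Finset (Fin n)), KneserColoring.IsDisjointCover C k ℓ := ⟨C, hC⟩
    simp only [o, dif_pos hex]
    rw [KneserColoring.IsDisjointCover.kappa_eq hex.choose_spec hC]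
  have hpos : ∀ (n : ℕ) (C : Finset (Finset (Fin n))), KneserColoring.IsDisjointCover C k ℓ →
      (0 : ℝ) < KneserColoring.kappa (KneserColoring.completeHypergraph C r) k ℓ :=
    fun n C hC => Nat.cast_pos.2 (hC.kappa_pos hk)
  refine ⟨o, ?_, fun n C hC => ?_⟩
  · obtain ⟨x, hx⟩ := KneserColoring.exists_isRate k
    refine squeeze_zero' (Filter.Eventually.of_forall fun n => ?_) ?_
      (KneserColoring.tendsto_pow_mul_pow_choose hℓr k
        (KneserColoring.errorExponent r ℓ k * (k + 1) + (2 * k + k * k) + 1 + k * (k * k))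
        hx.1 hx.2.1)
    · by_cases h : ∃ C : Finset (Finset (Fin n)), KneserColoring.IsDisjointCover C k ℓ
      · obtain ⟨C, hC⟩ := h
        rw [ho n C hC, sub_nonneg, one_le_div (hpos n C hC), Nat.cast_le]
        exact KneserColoring.kappa_le_KC C k ℓ
      · simp only [o, dif_neg h, le_refl]
    · filter_upwards [Filter.eventually_ge_atTop r, Filter.eventually_ge_atTop ((k + 2) / 3 * ℓ),
        KneserColoring.eventually_mul_pow_lt_choose hℓr k] with n h1 h2 h3
      obtain ⟨C, hC⟩ := KneserColoring.exists_isDisjointCover n k ℓ hℓ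
        (by rwa [KneserColoring.ceil_div_three])
      rw [ho n C hC, sub_le_iff_le_add, div_le_iff₀ (hpos n C hC), add_comm _ (1 : ℝ)]
      exact KneserColoring.KC_le hℓ hℓr hk h1 h2 h3 hx hC
  · rw [ho n C hC, add_sub_cancel, div_mul_cancel₀ _ (hpos n C hC).ne']
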